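/- Let $k$ be an algebraically closed field of characteristic $p>0$. A normal variety over $k$ is a normal integral separated scheme of finite type over $k$. Let $g\colon X'\to X$ be a finite separable morphism of normal varieties over $k$, i.e. a finite dominant $k$-morphism whose extension of function fields $k(X')/k(X)$ is separable. Let $\Delta$ and $\Delta'$ be $\mathbb{Q}$-Weil divisors (not necessarily effective) on $X$ and $X'$. Let $\omega$ be a non-zero rational differential form of top degree on $X$, and take the canonical divisors $K_X=\operatorname{div}(\omega)$ and $K_{X'}=\operatorname{div}(g^*\omega)$. Assume that $K_X+\Delta$ is $\mathbb{Q}$-Cartier and that $$g^{*}(K_X+\Delta)=K_{X'}+\Delta'$$ as $\mathbb{Q}$-divisors. If $(X,\Delta)$ is log canonical, then $(X',\Delta')$ is log canonical. Here, for a $\mathbb{Q}$-divisor $\Delta$ on a normal variety $X$, the pair $(X,\Delta)$ is log canonical if $K_X+\Delta$ is $\mathbb{Q}$-Cartier and, for every birational morphism $\pi\colon Y\to X$ over $k$ from a normal variety $Y$ and every prime divisor $E$ on $Y$, the discrepancy $a(E;X,\Delta)$ is at least $-1$. The discrepancy is the coefficient of $E$ in $K_Y-\pi^{*}(K_X+\Delta)$,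 where $K_X=\operatorname{div}(\omega)$ and $K_Y=\operatorname{div}(\pi^*\omega)$ for a non-zero rational top form $\omega$ on $X$; this does not depend on $\omega$. -/

import Mathlib

open CategoryTheory AlgebraicGeometry

universe u

noncomputable section

/-! ### Pulling back differential forms along an extension of `k`-algebras -/

/-- The pull-back of differential forms `⋀ Ω_{A/k} → ⋀ Ω_{B/k}` induced by a homomorphism
`φ : A → B` of `k`-algebras: `a₀ da₁ ∧ ⋯ ∧ daₙ ↦ φ(a₀) dφ(a₁) ∧ ⋯ ∧ dφ(aₙ)`. -/
def formPullback {k A B : Type u} [CommRing k] [CommRing A] [CommRing B] [Algebra k A]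
    [Algebra k B] (φ : A →ₐ[k] B) :
    ExteriorAlgebra A (KaehlerDifferential k A) →+*
      ExteriorAlgebra B (KaehlerDifferential k B) :=
  letI : Algebra A B := φ.toRingHom.toAlgebra
  haveI : IsScalarTower k A B := IsScalarTower.of_algebraMap_eq fun r => (φ.commutes r).symm
  (ExteriorAlgebra.lift A
    ⟨(ExteriorAlgebra.ι B).restrictScalars A ∘ₗ KaehlerDifferential.map k k A B,
      fun m => ExteriorAlgebra.ι_sq_zero (R := B) (KaehlerDifferential.map k k A B m)⟩ :
    ExteriorAlgebra A (KaehlerDifferential k A) →ₐ[A]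
      ExteriorAlgebra B (KaehlerDifferential k B)).toRingHom

/-! ### Normal varieties -/

/-- A normal variety over a field `k`: an integral separated scheme of finite type over `k` all of
whose local rings are integrally closed. -/
structure NormalVariety (k : Type u) [Field k] where
  /-- The underlying scheme. -/
  toScheme : Scheme.{u}
  /-- The structure morphism. -/
  str : toScheme ⟶ Spec (CommRingCat.of k)
  isIntegral : IsIntegral toScheme
  isSeparated : IsSeparated str
  locallyOfFiniteType : LocallyOfFiniteType str
  quasiCompact : QuasiCompact str
  isIntegrallyClosed_stalk : ∀ x : toScheme, IsIntegrallyClosed (toScheme.presheaf.stalk x)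

namespace NormalVariety

variable {k : Type u} [Field k]

instance (X : NormalVariety k) : IsIntegral X.toScheme := X.isIntegral

instance (X : NormalVariety k) : IsLocallyNoetherian X.toScheme :=
  haveI := X.locallyOfFiniteType
  LocallyOfFiniteType.isLocallyNoetherian X.str

/-- The field `k(X)` of rational functions on `X`. -/
abbrev FunctionField (X : NormalVariety k) : Type u := X.toScheme.functionField

/-- The homomorphism `k → Γ(X, ⊤)` given by the structure morphism. -/
def scalars (X : NormalVariety k) : CommRingCat.of k ⟶ Γ(X.toScheme, ⊤) :=
  (Scheme.ΓSpecIso (CommRingCat.of k)).inv ≫ X.str.appTop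

instance (X : NormalVariety k) : Algebra k X.FunctionField :=
  (X.scalars ≫ X.toScheme.presheaf.germ ⊤ (genericPoint X.toScheme)
    (TopologicalSpace.Opens.mem_top _)).hom.toAlgebra

/-- A prime divisor on `X`, given by its generic point, a point of codimension one. -/
def PrimeDivisor (X : NormalVariety k) : Type u := {x : X.toScheme // Order.coheight x = 1}

/-- The order of vanishing of a rational function along a prime divisor. -/
def ord (X : NormalVariety k) (f : X.FunctionField) (E : X.PrimeDivisor) : ℤ :=
  X.toScheme.ord f E.1

/-- `ℚ`-Weil divisors: finite formal sums of prime divisors with rational coefficients. -/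
abbrev QDivisor (X : NormalVariety k) : Type u := X.PrimeDivisor →₀ ℚ

/-! ### Rational differential forms and canonical divisors -/

/-- Rational differential forms on `X` (of all degrees), i.e. the exterior algebra of `Ω_{k(X)/k}`
over `k(X)`. -/
abbrev RationalForm (X : NormalVariety k) : Type u :=
  ExteriorAlgebra X.FunctionField (KaehlerDifferential k X.FunctionField)

/-- The degree of the highest non-vanishing exterior power of `Ω_{k(X)/k}`, which is the dimension
of `X` when `k` is perfect. -/
def topDegree (X : NormalVariety k) : ℕ :=
  Module.finrank X.FunctionField (KaehlerDifferential k X.FunctionField)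

/-- `ω` is a non-zero rational differential form of top degree on `X`. -/
def IsTopForm (X : NormalVariety k) (ω : X.RationalForm) : Prop :=
  ω ∈ ⋀[X.FunctionField]^X.topDegree (KaehlerDifferential k X.FunctionField) ∧ ω ≠ 0

/-- The rational forms of top degree that are regular at `x`: the image of the top exterior power
of `Ω_{𝒪_{X,x}/k}`, that is, the `𝒪_{X,x}`-linear combinations of `da₁ ∧ ⋯ ∧ daₙ` with
`a₁, …, aₙ ∈ 𝒪_{X,x}`. -/
def regularForms (X : NormalVariety k) (x : X.toScheme) :
    Submodule (X.toScheme.presheaf.stalk x) X.RationalForm :=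
  Submodule.span _ (Set.range fun a : Fin X.topDegree → X.toScheme.presheaf.stalk x =>
    ExteriorAlgebra.ιMulti X.FunctionField X.topDegree fun i =>
      KaehlerDifferential.D k X.FunctionField (algebraMap _ X.FunctionField (a i)))

/-- The order of a rational form `ω` of top degree along a prime divisor `E`: the largest integer
`m` such that `ω = f • η` with `f` a rational function of order `m` along `E` and `η` a form that is
regular at the generic point of `E`. The divisor `∑ ordForm ω E • E` is the canonical divisor
`K_X = div ω`. -/
def ordForm (X : NormalVariety k) (ω : X.RationalForm) (E : X.PrimeDivisor) : ℤ :=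
  sSup {m : ℤ | ∃ f : X.FunctionField, f ≠ 0 ∧ X.ord f E = m ∧ f⁻¹ • ω ∈ X.regularForms E.1}

/-- The coefficients of the divisor `K_X + Δ`, where `K_X = div ω`. -/
def logCanonicalDivisor (X : NormalVariety k) (ω : X.RationalForm) (Δ : X.QDivisor) :
    X.PrimeDivisor → ℚ :=
  fun E => X.ordForm ω E + Δ E

/-! ### `ℚ`-Cartier divisors -/

/-- `f` is an equation of `m D` in a neighbourhood of the point `x`. -/
def IsLocalEquation (X : NormalVariety k) (D : X.PrimeDivisor → ℚ) (x : X.toScheme) (m : ℕ)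
    (f : X.FunctionField) : Prop :=
  0 < m ∧ f ≠ 0 ∧ ∃ U : X.toScheme.Opens, x ∈ U ∧
    ∀ E : X.PrimeDivisor, E.1 ∈ U → (m : ℚ) * D E = X.ord f E

/-- `D` is `ℚ`-Cartier: some positive multiple `m D` is locally principal. -/
def IsQCartier (X : NormalVariety k) (D : X.PrimeDivisor → ℚ) : Prop :=
  ∃ m : ℕ, 0 < m ∧ ∀ x : X.toScheme, ∃ f : X.FunctionField, X.IsLocalEquation D x m f

/-! ### Dominant morphisms -/

/-- A dominant morphism of normal varieties over `k`. -/
structure DominantMorphism (Y X : NormalVariety k) where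
  /-- The underlying morphism of schemes. -/
  hom : Y.toScheme ⟶ X.toScheme
  comp_str : hom ≫ X.str = Y.str
  isDominant : IsDominant hom

namespace DominantMorphism

variable {X Y : NormalVariety k}

theorem map_genericPoint (φ : DominantMorphism Y X) :
    φ.hom (genericPoint Y.toScheme) = genericPoint X.toScheme := by
  have := φ.isDominant
  apply IsGenericPoint.eq _ (genericPoint_spec X.toScheme)
  have h := (genericPoint_spec Y.toScheme).image φ.hom.continuous
  rwa [Set.image_univ, φ.hom.denseRange.closure_range] at h

/-- The pull-back `k(X) → k(Y)` of rational functions, as a ring homomorphism: the map on the local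
rings at the generic points. -/
def functionFieldHom (φ : DominantMorphism Y X) :
    X.toScheme.functionField ⟶ Y.toScheme.functionField :=
  X.toScheme.presheaf.stalkSpecializes (specializes_of_eq φ.map_genericPoint) ≫
    φ.hom.stalkMap (genericPoint Y.toScheme)

/-- The pull-back `k(X) → k(Y)` of rational functions. -/
def functionFieldMap (φ : DominantMorphism Y X) : X.FunctionField →ₐ[k] Y.FunctionField where
  toRingHom := φ.functionFieldHom.hom
  commutes' r := by
    have h : X.scalars ≫
        X.toScheme.presheaf.germ ⊤ (genericPoint X.toScheme) (TopologicalSpace.Opens.mem_top _) ≫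
        φ.functionFieldHom =
        Y.scalars ≫
        Y.toScheme.presheaf.germ ⊤ (genericPoint Y.toScheme) (TopologicalSpace.Opens.mem_top _) := by
      have hs : Y.scalars = X.scalars ≫ φ.hom.appTop := by
        simp [scalars, ← φ.comp_str]
      rw [hs, functionFieldHom, TopCat.Presheaf.germ_stalkSpecializes_assoc,
        Scheme.Hom.germ_stalkMap]
      simp
    exact congrArg (fun f : CommRingCat.of k ⟶ Y.toScheme.functionField => f.hom r) h

/-- The coefficients of the pull-back `φ^* D` of a `ℚ`-Cartier divisor: if `f` is an equation of
`m D` around the image of the generic point of `E`, then the coefficient of `φ^* D` along `E` is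
`ord_E(φ^* f) / m`. As `X` is normal, this does not depend on `m` and `f`. -/
def pullback (φ : DominantMorphism Y X) (D : X.PrimeDivisor → ℚ) : Y.PrimeDivisor → ℚ :=
  open scoped Classical in
  fun E =>
    if h : ∃ p : ℕ × X.FunctionField, X.IsLocalEquation D (φ.hom E.1) p.1 p.2 then
      (Y.ord (φ.functionFieldMap h.choose.2) E : ℚ) / h.choose.1
    else 0

/-- The pull-back of rational differential forms. -/
def pullbackForm (φ : DominantMorphism Y X) (ω : X.RationalForm) : Y.RationalForm :=
  formPullback φ.functionFieldMap ω

/-- A dominant morphism is separable if it induces a separable extension of function fields. -/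
def IsSeparable (φ : DominantMorphism Y X) : Prop :=
  letI : Algebra X.FunctionField Y.FunctionField := φ.functionFieldMap.toRingHom.toAlgebra
  Algebra.IsSeparable X.FunctionField Y.FunctionField

/-- A dominant morphism of varieties is birational if it induces an isomorphism of function
fields. -/
def IsBirational (φ : DominantMorphism Y X) : Prop :=
  Function.Bijective φ.functionFieldMap

end DominantMorphism

/-! ### Discrepancies and log canonical pairs -/

/-- The discrepancy `a(E; X, Δ)` of a prime divisor `E` on `Y`, for a birational morphism
`π : Y → X`: the coefficient of `K_Y - π^*(K_X + Δ)` along `E`, where `K_X = div ω` and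
`K_Y = div (π^* ω)` for a rational form `ω` of top degree on `X`. -/
def discrepancy {X Y : NormalVariety k} (π : DominantMorphism Y X) (ω : X.RationalForm)
    (Δ : X.QDivisor) (E : Y.PrimeDivisor) : ℚ :=
  Y.ordForm (π.pullbackForm ω) E - π.pullback (X.logCanonicalDivisor ω Δ) E

/-- The pair `(X, Δ)` is log canonical: `K_X + Δ` is `ℚ`-Cartier and every discrepancy is at
least `-1`. None of this depends on the rational form `ω` that represents the canonical class. The
divisor `Δ` is not required to be effective. -/
def IsLogCanonical (X : NormalVariety k) (Δ : X.QDivisor) : Prop :=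
  ∀ ω : X.RationalForm, X.IsTopForm ω →
    X.IsQCartier (X.logCanonicalDivisor ω Δ) ∧
    ∀ (Y : NormalVariety k) (π : DominantMorphism Y X), π.IsBirational →
      ∀ E : Y.PrimeDivisor, -1 ≤ discrepancy π ω Δ E

end NormalVariety

end

/-!
Discrepancies of `(X', Δ')` are discrepancies of `(X, Δ)` along divisors `E'` over `X'`, because the
pull-back is crepant. Restrict the valuation of `E'` to `k(X)`. Since `k(X')` is algebraic over
`k(X)`, the residue field of the restriction still has transcendence degree `dim X - 1` over `k`,
so the restriction is the valuation of a divisor `E` over `X`: if `x₁, …, xₙ₋₁` lift a transcendence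
basis of the residue field and `t` lies in the maximal ideal, the valuation ring is a local ring of
the integral closure of `k[x₁, …, xₙ₋₁, t]` in it, and this integral closure is of finite type once
the lifts are chosen with `dx₁, …, dxₙ₋₁, dt` independent, as `k(X)` is then finite separable over
`k(x₁, …, xₙ₋₁, t)`. If `e` is the ramification index of `E'` over `E`, a uniformizer along `E` is
`u sᵉ` with `s` a uniformizer along `E'`, and `d(u sᵉ)` is divisible by `sᵉ⁻¹`; this gives the
Riemann–Hurwitz inequality `a(E') + 1 ≥ e (a(E) + 1)`, in which wild ramification does no harm.
-/

/-! ### Differentials of local rings and transcendence degree -/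

section SpanningDifferentials

open TensorProduct IsLocalRing KaehlerDifferential

section

open scoped IntermediateField.algebraAdjoinAdjoin

theorem finrank_kaehlerDifferential_of_algebraicIndependent {k L ι : Type u} [Field k] [Field L]
    [Algebra k L] {v : ι → L} (hv : AlgebraicIndependent k v)
    [Algebra.IsSeparable (IntermediateField.adjoin k (Set.range v)) L] :
    Module.finrank L Ω[L⁄k] = Nat.card ι := by
  let P := MvPolynomial ι k
  let A := Algebra.adjoin k (Set.range v)
  let F := IntermediateField.adjoin k (Set.range v)
  let : Algebra P A := hv.aevalEquiv.toAlgHom.toRingHom.toAlgebra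
  have : IsScalarTower k P A :=
    IsScalarTower.of_algebraMap_eq fun r => (hv.aevalEquiv.commutes r).symm
  let : Algebra P L := ((algebraMap A L).comp (algebraMap P A)).toAlgebra
  have : IsScalarTower P A L := IsScalarTower.of_algebraMap_eq fun _ => rfl
  have : IsScalarTower k P L := IsScalarTower.of_algebraMap_eq fun r => by
    rw [IsScalarTower.algebraMap_apply P A L, ← IsScalarTower.algebraMap_apply k P A,
      ← IsScalarTower.algebraMap_apply k A L]
  have : Algebra.FormallyEtale P A :=
    Algebra.FormallyEtale.of_equiv (R := P)
      ({ hv.aevalEquiv.toRingEquiv with commutes' := fun _ => rfl } : P ≃ₐ[P] A)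
  have : Algebra.FormallyEtale A F := Algebra.FormallyEtale.of_isLocalization (nonZeroDivisors A)
  have : Algebra.FormallyEtale F L := Algebra.FormallyEtale.of_isSeparable F L
  have : Algebra.FormallyEtale A L := Algebra.FormallyEtale.comp A F L
  have : Algebra.FormallyEtale P L := Algebra.FormallyEtale.comp P A L
  rw [← (tensorKaehlerEquivOfFormallyEtale k P L).finrank_eq, Module.finrank_baseChange,
    Module.finrank_eq_nat_card_basis (mvPolynomialBasis k ι)]

end

theorem trdeg_eq_finrank_kaehlerDifferential (k L : Type u) [Field k] [Field L] [Algebra k L]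
    [PerfectField k] [Algebra.EssFiniteType k L] :
    Algebra.trdeg k L = Module.finrank L Ω[L⁄k] := by
  obtain ⟨s, hs, hsep⟩ := exists_isTranscendenceBasis_and_isSeparable_of_perfectField k L
  have : Algebra.IsSeparable (IntermediateField.adjoin k (Set.range ((↑) : s → L))) L := by
    convert! hsep <;> simp
  rw [finrank_kaehlerDifferential_of_algebraicIndependent hs.1, ← hs.cardinalMk_eq_trdeg]
  simp

theorem transcendental_of_forall_isUnit {A R : Type*} [CommRing A] [CommRing R] [IsDomain R]
    [Algebra A R] (hA : ∀ a : A, a ≠ 0 → IsUnit (algebraMap A R a)) {t : R} (ht : t ≠ 0)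
    (ht' : ¬ IsUnit t) : Transcendental A t := by
  rintro ⟨p, hp, hpt⟩
  obtain ⟨q, hpq, hq⟩ := Polynomial.exists_eq_pow_rootMultiplicity_mul_and_not_dvd p hp 0
  rw [map_zero, sub_zero] at hpq hq
  have hqt : Polynomial.aeval t q = 0 := by
    rw [hpq] at hpt
    simpa [ht] using hpt
  have hq0 : q.coeff 0 ≠ 0 := fun h => hq (Polynomial.X_dvd_iff.mpr h)
  have hdvd : t ∣ algebraMap A R (q.coeff 0) := by
    rw [← Polynomial.divX_mul_X_add q] at hqt
    simp only [map_add, map_mul, Polynomial.aeval_X, Polynomial.aeval_C] at hqt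
    exact ⟨-Polynomial.aeval t q.divX, by linear_combination hqt⟩
  exact ht' (isUnit_of_dvd_unit hdvd (hA _ hq0))

theorem isUnit_aeval_of_algebraicIndependent_residue {k R ι : Type*} [CommRing k] [CommRing R]
    [IsLocalRing R] [Algebra k R] {x : ι → R}
    (hx : AlgebraicIndependent k fun i => residue R (x i)) {P : MvPolynomial ι k} (hP : P ≠ 0) :
    IsUnit (MvPolynomial.aeval x P) := by
  have hres : residue R (MvPolynomial.aeval x P) =
      MvPolynomial.aeval (fun i => residue R (x i)) P :=
    MvPolynomial.comp_aeval_apply x (IsScalarTower.toAlgHom k R (ResidueField R)) P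
  rw [← residue_ne_zero_iff_isUnit, hres]
  exact fun h => hP ((injective_iff_map_eq_zero _).mp hx P h)

theorem algebraicIndependent_option_of_residue {k R ι : Type*} [CommRing k] [CommRing R]
    [IsDomain R] [IsLocalRing R] [Algebra k R] {x : ι → R}
    (hx : AlgebraicIndependent k fun i => residue R (x i)) {t : R} (ht : t ≠ 0)
    (ht' : ¬ IsUnit t) : AlgebraicIndependent k (fun o : Option ι => o.elim t x) := by
  have hx' : AlgebraicIndependent k x :=
    .of_comp (IsScalarTower.toAlgHom k R (ResidueField R)) hx
  rw [hx'.option_iff_transcendental]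
  refine transcendental_of_forall_isUnit (fun a ha => ?_) ht ht'
  obtain ⟨P, rfl⟩ := hx'.aevalEquiv.surjective a
  rw [hx'.algebraMap_aevalEquiv]
  exact isUnit_aeval_of_algebraicIndependent_residue hx fun h => ha (by rw [h, map_zero])

theorem exists_fin_span_range_comp_eq_top {K V ι : Type*} [DivisionRing K] [AddCommGroup V]
    [Module K V] [FiniteDimensional K V] {v : ι → V}
    (hv : Submodule.span K (Set.range v) = ⊤) :
    ∃ i : Fin (Module.finrank K V) → ι, Submodule.span K (Set.range (v ∘ i)) = ⊤ := by
  obtain ⟨b, hb, hspan, -⟩ := Submodule.exists_fun_fin_finrank_span_eq K (Set.range v)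
  choose i hi using hb
  have hn : Module.finrank K V = Module.finrank K (Submodule.span K (Set.range v)) := by
    rw [hv, finrank_top]
  refine ⟨i ∘ finCongr hn, ?_⟩
  rw [← Function.comp_assoc, (finCongr hn).surjective.range_comp, show v ∘ i = b from funext hi,
    hspan, hv]

theorem ker_mapBaseChange_residueField_le {k R : Type*} [CommRing k] [CommRing R] [IsLocalRing R]
    [Algebra k R] {t : R} (ht : maximalIdeal R = Ideal.span {t}) :
    LinearMap.ker (mapBaseChange k R (ResidueField R)) ≤
      Submodule.span (ResidueField R) {1 ⊗ₜ D k R t} := by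
  intro z hz
  obtain ⟨y, rfl⟩ := (exact_kerCotangentToTensor_mapBaseChange k R (ResidueField R)
    residue_surjective z).mp hz
  obtain ⟨⟨y, hy⟩, rfl⟩ := Ideal.toCotangent_surjective _ y
  rw [kerCotangentToTensor_toCotangent]
  obtain ⟨c, rfl⟩ : t ∣ y := by
    rw [← Ideal.mem_span_singleton, ← ht]
    exact (residue_eq_zero_iff y).mp hy
  have ht0 : algebraMap R (ResidueField R) t = 0 :=
    (residue_eq_zero_iff t).mpr (ht ▸ Ideal.mem_span_singleton_self t)
  have hleibniz : (1 : ResidueField R) ⊗ₜ[R] D k R (t * c) =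
      residue R c • ((1 : ResidueField R) ⊗ₜ[R] D k R t) := by
    rw [Derivation.leibniz, tmul_add, ← smul_tmul, ← smul_tmul, Algebra.smul_def, ht0, zero_mul,
      zero_tmul, zero_add, smul_tmul', Algebra.smul_def]
    rfl
  rw [hleibniz]
  exact Submodule.smul_mem _ _ (Submodule.mem_span_singleton_self _)

theorem span_D_option_eq_top {k R ι : Type*} [CommRing k] [CommRing R] [IsLocalRing R]
    [Algebra k R] [Algebra.EssFiniteType k R] {t : R} (ht : maximalIdeal R = Ideal.span {t})
    {x : ι → R} (hx : Submodule.span (ResidueField R)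
      (Set.range fun i => D k (ResidueField R) (residue R (x i))) = ⊤) :
    Submodule.span R (Set.range fun o : Option ι => D k R (o.elim t x)) = ⊤ := by
  rw [← map_tensorProduct_mk_eq_top, Submodule.map_span, ← Submodule.restrictScalars_span R
    (ResidueField R) residue_surjective, Submodule.restrictScalars_eq_top_iff]
  set N := Submodule.span (ResidueField R) ((TensorProduct.mk R (ResidueField R) Ω[R⁄k] 1) ''
    Set.range fun o : Option ι => D k R (o.elim t x))
  have hmem (o : Option ι) : (1 : ResidueField R) ⊗ₜ[R] D k R (o.elim t x) ∈ N :=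
    Submodule.subset_span ⟨_, ⟨o, rfl⟩, rfl⟩
  have hmap : N.map (mapBaseChange k R (ResidueField R)) = ⊤ := by
    rw [eq_top_iff, ← hx, Submodule.span_le]
    rintro _ ⟨i, rfl⟩
    exact ⟨_, hmem (some i), by simp⟩
  have hker : LinearMap.ker (mapBaseChange k R (ResidueField R)) ≤ N :=
    (ker_mapBaseChange_residueField_le ht).trans
      ((Submodule.span_singleton_le_iff_mem _ _).mpr (hmem none))
  rw [← Submodule.comap_map_eq_self hker, hmap, Submodule.comap_top]

theorem span_D_algebraMap_eq_top {k R : Type*} (K : Type*) [CommRing k] [CommRing R] [Algebra k R]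
    [CommRing K] [Algebra R K] [IsFractionRing R K] [Algebra k K] [IsScalarTower k R K]
    {ι : Type*} {x : ι → R} (hx : Submodule.span R (Set.range fun i => D k R (x i)) = ⊤) :
    Submodule.span K (Set.range fun i => D k K (algebraMap R K (x i))) = ⊤ := by
  simpa [← Set.range_comp, Function.comp_def] using
    span_eq_top_of_isLocalizedModule K (nonZeroDivisors R) (KaehlerDifferential.map k k R K) hx

theorem essFiniteType_fractionRing (k R K : Type*) [CommRing k] [CommRing R] [Algebra k R]
    [CommRing K] [Algebra R K] [IsFractionRing R K] [Algebra k K] [IsScalarTower k R K]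
    [Algebra.EssFiniteType k R] : Algebra.EssFiniteType k K :=
  have : Algebra.EssFiniteType R K := .of_isLocalization K (nonZeroDivisors R)
  .comp k R K

section DiscreteValuationRing

variable (k R K : Type u) [Field k] [CommRing R] [Algebra k R] [Field K] [Algebra R K]
  [IsFractionRing R K] [Algebra k K] [IsScalarTower k R K]

theorem trdeg_residueField_add_one_le [IsDomain R] [IsLocalRing R] (hR : ¬ IsField R) :
    Algebra.trdeg k (ResidueField R) + 1 ≤ Algebra.trdeg k K := by
  obtain ⟨t, htm, ht0⟩ := Submodule.exists_mem_ne_zero_of_ne_bot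
    (isField_iff_maximalIdeal_eq.not.mp hR)
  obtain ⟨ι, z, hz⟩ := exists_isTranscendenceBasis' k (ResidueField R)
  choose x hx using fun i => residue_surjective (R := R) (z i)
  have hind : AlgebraicIndependent k fun i => residue R (x i) := by simpa only [hx] using hz.1
  have hle := ((algebraicIndependent_option_of_residue hind ht0 ((mem_maximalIdeal t).mp htm)).map'
    (f := IsScalarTower.toAlgHom k R K) (IsFractionRing.injective R K)).cardinalMk_le_trdeg
  rwa [Cardinal.mk_option, hz.cardinalMk_eq_trdeg] at hle

variable [IsDomain R] [IsDiscreteValuationRing R] [Algebra.EssFiniteType k R]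

theorem exists_irreducible_span_D_option_eq_top : ∃ (t : R)
    (x : Fin (Module.finrank (ResidueField R) Ω[ResidueField R⁄k]) → R), Irreducible t ∧
    Submodule.span R (Set.range fun o : Option (Fin _) => D k R (o.elim t x)) = ⊤ := by
  have : Algebra.EssFiniteType k (ResidueField R) := .comp k R _
  obtain ⟨t, ht⟩ := IsDiscreteValuationRing.exists_irreducible R
  obtain ⟨z, hz⟩ :=
    exists_fin_span_range_comp_eq_top (span_range_derivation k (ResidueField R))
  choose x hx using fun i => residue_surjective (R := R) (z i)
  exact ⟨t, x, ht, span_D_option_eq_top ht.maximalIdeal_eq (by simpa only [hx] using! hz)⟩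

variable [PerfectField k]

theorem finrank_kaehlerDifferential_eq_residueField_add_one :
    Module.finrank K Ω[K⁄k] = Module.finrank (ResidueField R) Ω[ResidueField R⁄k] + 1 := by
  have : Algebra.EssFiniteType k K := essFiniteType_fractionRing k R K
  have : Algebra.EssFiniteType k (ResidueField R) := .comp k R _
  apply le_antisymm
  · obtain ⟨t, x, -, hspan⟩ := exists_irreducible_span_D_option_eq_top k R
    have hle := finrank_range_le_card (R := K)
      fun o : Option (Fin _) => D k K (algebraMap R K (o.elim t x))
    rwa [Set.finrank, span_D_algebraMap_eq_top K hspan, finrank_top, Fintype.card_option,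
      Fintype.card_fin] at hle
  · have hle := trdeg_residueField_add_one_le k R K (IsDiscreteValuationRing.not_isField R)
    rw [trdeg_eq_finrank_kaehlerDifferential, trdeg_eq_finrank_kaehlerDifferential] at hle
    exact_mod_cast hle

theorem trdeg_residueField_add_one :
    Algebra.trdeg k (ResidueField R) + 1 = Algebra.trdeg k K := by
  have : Algebra.EssFiniteType k K := essFiniteType_fractionRing k R K
  have : Algebra.EssFiniteType k (ResidueField R) := .comp k R _
  rw [trdeg_eq_finrank_kaehlerDifferential, trdeg_eq_finrank_kaehlerDifferential,
    finrank_kaehlerDifferential_eq_residueField_add_one k R K]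
  norm_cast

theorem exists_irreducible_span_D_eq_top {n : ℕ} (hn : Module.finrank K Ω[K⁄k] = n) :
    ∃ (x : Fin n → R) (i : Fin n),
      Irreducible (x i) ∧ Submodule.span R (Set.range fun i => D k R (x i)) = ⊤ := by
  obtain ⟨t, x, ht, hspan⟩ := exists_irreducible_span_D_option_eq_top k R
  obtain rfl : _ = n :=
    (finrank_kaehlerDifferential_eq_residueField_add_one k R K).symm.trans hn
  refine ⟨fun i => (finSuccEquiv _ i).elim t x, 0, by simpa using ht, ?_⟩
  rw [← hspan, ← (finSuccEquiv _).surjective.range_comp]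
  rfl

end DiscreteValuationRing

end SpanningDifferentials

/-! ### Forms of top degree -/

section TopForms

open ExteriorAlgebra KaehlerDifferential

theorem alternatingMap_sum_smul_eq_det_smul {R M N ι : Type*} [CommRing R] [AddCommGroup M]
    [Module R M] [AddCommGroup N] [Module R N] [Fintype ι] [DecidableEq ι]
    (f : M [⋀^ι]→ₗ[R] N) (c : Matrix ι ι R) (x : ι → M) :
    f (fun i => ∑ j, c i j • x j) = c.det • f x := by
  suffices h : f.compLinearMap (Fintype.linearCombination R x) =
      (LinearMap.toSpanSingleton R N (f x)).compAlternatingMap (Pi.basisFun R ι).det by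
    simpa [Fintype.linearCombination_apply, Pi.basisFun_det_apply] using! congr($h c)
  refine (Pi.basisFun R ι).ext_alternating fun v hv => ?_
  let σ : Equiv.Perm ι := Equiv.ofBijective v (Finite.injective_iff_bijective.mp hv)
  have hf : f (fun i => x (v i)) = Equiv.Perm.sign σ • f x := f.map_perm x σ
  have hdet : (Pi.basisFun R ι).det (fun i => Pi.basisFun R ι (v i)) = Equiv.Perm.sign σ • 1 := by
    rw [← (Pi.basisFun R ι).det_self]
    exact (Pi.basisFun R ι).det.map_perm (Pi.basisFun R ι) σ
  rw [AlternatingMap.compLinearMap_apply, LinearMap.compAlternatingMap_apply, hdet]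
  simp [hf]

theorem ιMulti_mem_span_singleton {R K M : Type*} [CommRing R] [CommRing K] [Algebra R K]
    [AddCommGroup M] [Module K M] [Module R M] [IsScalarTower R K M] {n : ℕ} {x v : Fin n → M}
    (hv : ∀ i, v i ∈ Submodule.span R (Set.range x)) :
    ιMulti K n v ∈ Submodule.span R {ιMulti K n x} := by
  choose c hc using fun i => (Submodule.mem_span_range_iff_exists_fun R).mp (hv i)
  have h := alternatingMap_sum_smul_eq_det_smul (ιMulti K n)
    ((algebraMap R K).mapMatrix (Matrix.of c)) x
  rw [← RingHom.map_det, algebraMap_smul] at h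
  refine Submodule.mem_span_singleton.mpr ⟨Matrix.det (Matrix.of c), h.symm.trans ?_⟩
  simp [hc]

theorem ιMulti_ne_zero_of_span_eq_top {K M : Type*} [Field K] [AddCommGroup M] [Module K M] {n : ℕ}
    (hn : Module.finrank K M = n) {x : Fin n → M} (hx : Submodule.span K (Set.range x) = ⊤) :
    ιMulti K n x ≠ 0 := by
  let b := basisOfTopLeSpanOfCardEqFinrank x hx.ge (by simp [hn])
  have hdet := exteriorPower.alternatingMapLinearEquiv_apply_ιMulti b.det b
  intro h
  have hb : exteriorPower.ιMulti K n b = 0 := Subtype.ext (by simpa [b] using h)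
  rw [hb, map_zero, b.det_self] at hdet
  exact zero_ne_one hdet

theorem exists_eq_smul_ιMulti {K M : Type*} [CommRing K] [AddCommGroup M] [Module K M] {n : ℕ}
    {x : Fin n → M} (hx : Submodule.span K (Set.range x) = ⊤) {ω : ExteriorAlgebra K M}
    (hω : ω ∈ ⋀[K]^n M) : ∃ c : K, ω = c • ιMulti K n x := by
  have hle : ⋀[K]^n M ≤ Submodule.span K {ιMulti K n x} := by
    rw [← exteriorPower.ιMulti_span_fixedDegree, Submodule.span_le]
    rintro _ ⟨v, rfl⟩
    exact ιMulti_mem_span_singleton fun i => hx ▸ Submodule.mem_top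
  obtain ⟨c, hc⟩ := Submodule.mem_span_singleton.mp (hle hω)
  exact ⟨c, hc.symm⟩

section Pullback

variable {k A B : Type u} [CommRing k] [CommRing A] [CommRing B] [Algebra k A] [Algebra k B]

theorem formPullback_smul (φ : A →ₐ[k] B) (c : A) (ω : ExteriorAlgebra A Ω[A⁄k]) :
    formPullback φ (c • ω) = φ c • formPullback φ ω := by
  let : Algebra A B := φ.toRingHom.toAlgebra
  have : IsScalarTower k A B := IsScalarTower.of_algebraMap_eq fun r => (φ.commutes r).symm
  simp only [formPullback, AlgHom.toRingHom_eq_coe, RingHom.coe_coe, map_smul]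
  exact (algebraMap_smul B c _).symm

theorem formPullback_ιMulti_D (φ : A →ₐ[k] B) {n : ℕ} (x : Fin n → A) :
    formPullback φ (ιMulti A n fun i => D k A (x i)) = ιMulti B n fun i => D k B (φ (x i)) := by
  let : Algebra A B := φ.toRingHom.toAlgebra
  have : IsScalarTower k A B := IsScalarTower.of_algebraMap_eq fun r => (φ.commutes r).symm
  rw [ιMulti_apply, ιMulti_apply, map_list_prod, List.map_ofFn]
  congr 2
  funext i
  simp only [formPullback, Function.comp_apply, AlgHom.toRingHom_eq_coe, RingHom.coe_coe,
    lift_ι_apply]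
  exact congrArg (ι B) (map_D k k A B (x i))

end Pullback

section SeparableExtension

variable {k K L M : Type u} [Field k] [Field K] [Field L] [Field M] [Algebra k K] [Algebra k L]
  [Algebra k M]

/-- A homomorphism of fields over `k` that makes its target a separable algebraic extension of its
source; it is unbundled because the function field of a variety is an algebra over that of another
one only through a chosen morphism. -/
def IsSeparableHom (φ : K →ₐ[k] L) : Prop :=
  letI : Algebra K L := φ.toRingHom.toAlgebra
  Algebra.IsSeparable K L

namespace IsSeparableHom

theorem of_bijective {φ : K →ₐ[k] L} (hφ : Function.Bijective φ) : IsSeparableHom φ := by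
  let : Algebra K L := φ.toRingHom.toAlgebra
  exact AlgEquiv.Algebra.isSeparable (AlgEquiv.ofBijective (Algebra.ofId K L) hφ)

theorem comp {ψ : L →ₐ[k] M} {φ : K →ₐ[k] L} (hψ : IsSeparableHom ψ) (hφ : IsSeparableHom φ) :
    IsSeparableHom (ψ.comp φ) := by
  let : Algebra K L := φ.toRingHom.toAlgebra
  let : Algebra L M := ψ.toRingHom.toAlgebra
  let : Algebra K M := (ψ.comp φ).toRingHom.toAlgebra
  have : IsScalarTower K L M := .of_algebraMap_eq fun _ => rfl
  have : Algebra.IsSeparable K L := hφ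
  have : Algebra.IsSeparable L M := hψ
  exact Algebra.IsSeparable.trans K L M

theorem of_comp {ψ : L →ₐ[k] M} {φ : K →ₐ[k] L} (h : IsSeparableHom (ψ.comp φ)) :
    IsSeparableHom ψ := by
  let : Algebra K L := φ.toRingHom.toAlgebra
  let : Algebra L M := ψ.toRingHom.toAlgebra
  let : Algebra K M := (ψ.comp φ).toRingHom.toAlgebra
  have : IsScalarTower K L M := .of_algebraMap_eq fun _ => rfl
  have : Algebra.IsSeparable K M := h
  exact Algebra.isSeparable_tower_top_of_isSeparable K L M

end IsSeparableHom

theorem finrank_kaehlerDifferential_eq_of_isSeparableHom {φ : K →ₐ[k] L} (hφ : IsSeparableHom φ) :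
    Module.finrank L Ω[L⁄k] = Module.finrank K Ω[K⁄k] := by
  let : Algebra K L := φ.toRingHom.toAlgebra
  have : IsScalarTower k K L := IsScalarTower.of_algebraMap_eq fun r => (φ.commutes r).symm
  have : Algebra.IsSeparable K L := hφ
  have : Algebra.FormallyEtale K L := Algebra.FormallyEtale.of_isSeparable K L
  rw [← (tensorKaehlerEquivOfFormallyEtale k K L).finrank_eq, Module.finrank_baseChange]

theorem span_D_map_eq_top {φ : K →ₐ[k] L} (hφ : IsSeparableHom φ) {ι : Type*} {x : ι → K}
    (hx : Submodule.span K (Set.range fun i => D k K (x i)) = ⊤) :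
    Submodule.span L (Set.range fun i => D k L (φ (x i))) = ⊤ := by
  let : Algebra K L := φ.toRingHom.toAlgebra
  have : IsScalarTower k K L := IsScalarTower.of_algebraMap_eq fun r => (φ.commutes r).symm
  have : Algebra.IsSeparable K L := hφ
  have : Algebra.FormallyUnramified K L := Algebra.FormallyUnramified.of_isSeparable K L
  have hsurj : LinearMap.range (mapBaseChange k K L) = ⊤ := by
    rw [range_mapBaseChange, eq_top_iff]
    exact fun z _ => Subsingleton.elim _ _
  rw [← hsurj, LinearMap.range_eq_map, ← Submodule.baseChange_top, ← hx, Submodule.baseChange_span,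
    Submodule.map_span, ← Set.range_comp, ← Set.range_comp]
  exact congrArg (fun y : ι → Ω[L⁄k] => Submodule.span L (Set.range y)) (funext fun i =>
    ((mapBaseChange_tmul k K L 1 (D k K (x i))).trans
      ((one_smul L _).trans (map_D k k K L (x i)))).symm)

theorem exists_fin_span_D_eq_top [Algebra.EssFiniteType k K] {n : ℕ}
    (hn : Module.finrank K Ω[K⁄k] = n) :
    ∃ x : Fin n → K, Submodule.span K (Set.range fun i => D k K (x i)) = ⊤ := by
  subst hn
  exact exists_fin_span_range_comp_eq_top (span_range_derivation k K)

variable [Algebra.EssFiniteType k K] {n : ℕ} {ω : ExteriorAlgebra K Ω[K⁄k]}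

theorem formPullback_mem_exteriorPower (φ : K →ₐ[k] L) (hn : Module.finrank K Ω[K⁄k] = n)
    (hω : ω ∈ ⋀[K]^n Ω[K⁄k]) : formPullback φ ω ∈ ⋀[L]^n Ω[L⁄k] := by
  obtain ⟨x, hx⟩ := exists_fin_span_D_eq_top hn
  obtain ⟨c, rfl⟩ := exists_eq_smul_ιMulti hx hω
  rw [formPullback_smul, formPullback_ιMulti_D]
  exact Submodule.smul_mem _ _ (ιMulti_range L n (Set.mem_range_self _))

theorem formPullback_ne_zero {φ : K →ₐ[k] L} (hφ : IsSeparableHom φ)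
    (hn : Module.finrank K Ω[K⁄k] = n) (hω : ω ∈ ⋀[K]^n Ω[K⁄k]) (h0 : ω ≠ 0) :
    formPullback φ ω ≠ 0 := by
  obtain ⟨x, hx⟩ := exists_fin_span_D_eq_top hn
  obtain ⟨c, rfl⟩ := exists_eq_smul_ιMulti hx hω
  rw [formPullback_smul, formPullback_ιMulti_D]
  exact smul_ne_zero ((map_ne_zero φ).mpr (left_ne_zero_of_smul h0)) (ιMulti_ne_zero_of_span_eq_top
    ((finrank_kaehlerDifferential_eq_of_isSeparableHom hφ).trans hn) (span_D_map_eq_top hφ hx))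

theorem formPullback_formPullback (φ : K →ₐ[k] L) (ψ : L →ₐ[k] M)
    (hn : Module.finrank K Ω[K⁄k] = n) (hω : ω ∈ ⋀[K]^n Ω[K⁄k]) :
    formPullback ψ (formPullback φ ω) = formPullback (ψ.comp φ) ω := by
  obtain ⟨x, hx⟩ := exists_fin_span_D_eq_top hn
  obtain ⟨c, rfl⟩ := exists_eq_smul_ιMulti hx hω
  simp only [formPullback_smul, formPullback_ιMulti_D, AlgHom.comp_apply]

end SeparableExtension

end TopForms

/-! ### Orders of functions and of forms along a discrete valuation ring -/

section Orders

/-- The order of vanishing of an element of the fraction field of a one-dimensional noetherian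
domain, additively written; the order of `0` is the junk value `0`. -/
noncomputable def fracOrd (R : Type*) {K : Type*} [CommRing R] [Nontrivial R]
    [IsNoetherianRing R] [Ring.KrullDimLE 1 R] [Field K] [Algebra R K] [IsFractionRing R K]
    (f : K) : ℤ :=
  WithZero.log (Ring.ordFrac R f)

section FracOrd

variable {R K : Type*} [CommRing R] [Nontrivial R] [IsNoetherianRing R] [Ring.KrullDimLE 1 R]
  [Field K] [Algebra R K] [IsFractionRing R K]

@[simp]
theorem fracOrd_zero : fracOrd R (0 : K) = 0 := by
  simp [fracOrd]

theorem fracOrd_mul {f g : K} (hf : f ≠ 0) (hg : g ≠ 0) :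
    fracOrd R (f * g) = fracOrd R f + fracOrd R g := by
  simp [fracOrd, WithZero.log_mul, hf, hg]

theorem fracOrd_inv (f : K) : fracOrd R f⁻¹ = -fracOrd R f := by
  simp [fracOrd]

theorem fracOrd_pow (f : K) (n : ℕ) : fracOrd R (f ^ n) = n * fracOrd R f := by
  simp [fracOrd]

theorem fracOrd_zpow (f : K) (n : ℤ) : fracOrd R (f ^ n) = n * fracOrd R f := by
  simp [fracOrd]

end FracOrd

section DiscreteValuationRing

variable {R K : Type*} [CommRing R] [IsDomain R] [IsDiscreteValuationRing R] [Field K]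
  [Algebra R K] [IsFractionRing R K]

theorem fracOrd_irreducible {ϖ : R} (h : Irreducible ϖ) : fracOrd R (algebraMap R K ϖ) = 1 := by
  simp [fracOrd, Ring.ordFrac_irreducible h]

theorem fracOrd_nonneg_iff {f : K} : 0 ≤ fracOrd R f ↔ f ∈ Set.range (algebraMap R K) := by
  rcases eq_or_ne f 0 with rfl | hf
  · exact ⟨fun _ => ⟨0, map_zero _⟩, fun _ => fracOrd_zero.ge⟩
  have h0 : Ring.ordFrac R f ≠ 0 := by simpa using hf
  rw [fracOrd, ← WithZero.log_one, WithZero.log_le_log one_ne_zero h0,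
    Ring.ordFrac_eq_valuation_inv, one_le_inv₀ (zero_lt_iff.mpr ((Valuation.ne_zero_iff _).mpr hf))]
  refine ⟨IsDiscreteValuationRing.exists_lift_of_le_one, ?_⟩
  rintro ⟨r, rfl⟩
  exact IsDedekindDomain.HeightOneSpectrum.valuation_le_one _ r

theorem fracOrd_eq_zero_iff {f : K} (hf : f ≠ 0) :
    fracOrd R f = 0 ↔ ∃ r : R, IsUnit r ∧ algebraMap R K r = f := by
  refine ⟨fun h => ?_, ?_⟩
  · obtain ⟨r, rfl⟩ := fracOrd_nonneg_iff.mp h.ge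
    obtain ⟨s, hs⟩ := (fracOrd_nonneg_iff (R := R) (f := (algebraMap R K r)⁻¹)).mp
      (by rw [fracOrd_inv, h, neg_zero])
    refine ⟨r, .of_mul_eq_one s (IsFractionRing.injective R K ?_), rfl⟩
    rw [map_mul, hs, map_one, mul_inv_cancel₀ hf]
  · rintro ⟨r, hr, rfl⟩
    simp [fracOrd, Ring.ordFrac_of_isUnit hr]

theorem fracOrd_le_iff {f g : K} (hf : f ≠ 0) (hg : g ≠ 0) :
    fracOrd R g ≤ fracOrd R f ↔ ∃ r : R, f = algebraMap R K r * g := by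
  rw [← sub_nonneg, sub_eq_add_neg, ← fracOrd_inv, ← fracOrd_mul hf (inv_ne_zero hg),
    fracOrd_nonneg_iff]
  exact exists_congr fun r => by rw [eq_mul_inv_iff_mul_eq₀ hg, eq_comm]

theorem exists_ramificationIdx {R' L : Type*} [CommRing R'] [IsDomain R']
    [IsDiscreteValuationRing R'] [Field L] [Algebra R' L] [IsFractionRing R' L] (ψ : K →+* L)
    (h : ∀ f, f ∈ Set.range (algebraMap R K) ↔ ψ f ∈ Set.range (algebraMap R' L)) :
    ∃ e : ℕ, 0 < e ∧ ∀ f, fracOrd R' (ψ f) = e * fracOrd R f := by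
  have hnonneg (f : K) : 0 ≤ fracOrd R f ↔ 0 ≤ fracOrd R' (ψ f) := by
    rw [fracOrd_nonneg_iff, fracOrd_nonneg_iff, h]
  have hnonpos (f : K) : fracOrd R f ≤ 0 ↔ fracOrd R' (ψ f) ≤ 0 := by
    simpa only [map_inv₀, fracOrd_inv, neg_nonneg] using hnonneg f⁻¹
  obtain ⟨ϖ, hϖ⟩ := IsDiscreteValuationRing.exists_irreducible R
  let t : K := algebraMap R K ϖ
  have ht0 : t ≠ 0 := (map_ne_zero_iff _ (IsFractionRing.injective R K)).mpr hϖ.ne_zero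
  have ht1 : fracOrd R t = 1 := fracOrd_irreducible hϖ
  have hpos : 0 < fracOrd R' (ψ t) := not_le.mp fun hle => by
    simpa [ht1] using (hnonpos t).mpr hle
  refine ⟨(fracOrd R' (ψ t)).toNat, by lia, fun f => ?_⟩
  rcases eq_or_ne f 0 with rfl | hf
  · simp
  have hz : t ^ (-fracOrd R f) ≠ 0 := zpow_ne_zero _ ht0
  have h0 : fracOrd R (f * t ^ (-fracOrd R f)) = 0 := by
    rw [fracOrd_mul hf hz, fracOrd_zpow, ht1]
    ring
  have h1 : fracOrd R' (ψ (f * t ^ (-fracOrd R f))) = 0 :=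
    le_antisymm ((hnonpos _).mp h0.le) ((hnonneg _).mp h0.ge)
  rw [map_mul, fracOrd_mul ((map_ne_zero ψ).mpr hf) ((map_ne_zero ψ).mpr hz), map_zpow₀,
    fracOrd_zpow] at h1
  rw [Int.toNat_of_nonneg hpos.le]
  linarith

end DiscreteValuationRing

open ExteriorAlgebra KaehlerDifferential

section Forms

variable (k R : Type u) {K : Type u} [CommRing k] [CommRing R] [Field K] [Algebra R K]
  [Algebra k K]

/-- The forms of degree `n` over the field `K` that come from `⋀ⁿ Ω_{R/k}`. -/
noncomputable def integralForms (n : ℕ) : Submodule R (ExteriorAlgebra K Ω[K⁄k]) :=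
  Submodule.span R (Set.range fun a : Fin n → R => ιMulti K n fun i => D k K (algebraMap R K (a i)))

variable {k R}

theorem integralForms_eq_span_singleton [Algebra k R] [IsScalarTower k R K] {n : ℕ} {x : Fin n → R}
    (hx : Submodule.span R (Set.range fun i => D k R (x i)) = ⊤) :
    integralForms k R n =
      Submodule.span R {ιMulti K n fun i => D k K (algebraMap R K (x i))} := by
  refine le_antisymm (Submodule.span_le.mpr ?_)
    (Submodule.span_mono (Set.singleton_subset_iff.mpr ⟨x, rfl⟩))
  rintro _ ⟨a, rfl⟩
  refine ιMulti_mem_span_singleton fun i => ?_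
  have h : D k R (a i) ∈ Submodule.span R (Set.range fun i => D k R (x i)) := hx ▸ trivial
  have hmap := Submodule.mem_map_of_mem (f := KaehlerDifferential.map k k R K) h
  rw [Submodule.map_span, ← Set.range_comp] at hmap
  simpa [Function.comp_def] using hmap

end Forms

section FormOrd

variable (k R : Type u) {K : Type u} [Field k] [CommRing R] [IsDomain R] [IsDiscreteValuationRing R]
  [Field K] [Algebra R K] [IsFractionRing R K] [Algebra k K]

/-- The order of a form of degree `n` along a discrete valuation ring: the largest order of a
function `f` such that `ω` is `f` times a form that comes from `⋀ⁿ Ω_{R/k}`. -/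
noncomputable def formOrd (n : ℕ) (ω : ExteriorAlgebra K Ω[K⁄k]) : ℤ :=
  sSup {m : ℤ | ∃ f : K, f ≠ 0 ∧ fracOrd R f = m ∧ f⁻¹ • ω ∈ integralForms k R n}

variable {k R}

theorem inv_smul_smul_mem_integralForms_iff {n : ℕ} {η : ExteriorAlgebra K Ω[K⁄k]} (hη : η ≠ 0)
    (hspan : integralForms k R n = Submodule.span R {η}) {f h : K} (hf : f ≠ 0) (hh : h ≠ 0) :
    f⁻¹ • h • η ∈ integralForms k R n ↔ fracOrd R f ≤ fracOrd R h := by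
  rw [hspan, Submodule.mem_span_singleton, fracOrd_le_iff hh hf]
  refine exists_congr fun r => ?_
  rw [smul_smul, ← algebraMap_smul K, (smul_left_injective K hη).eq_iff, inv_mul_eq_div,
    eq_div_iff hf, eq_comm]

theorem formOrd_smul_of_integralForms_eq_span {n : ℕ} {η : ExteriorAlgebra K Ω[K⁄k]} (hη : η ≠ 0)
    (hspan : integralForms k R n = Submodule.span R {η}) {h : K} (hh : h ≠ 0) :
    formOrd k R n (h • η) = fracOrd R h := by
  refine IsGreatest.csSup_eq ⟨⟨h, hh, rfl, ?_⟩, ?_⟩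
  · exact (inv_smul_smul_mem_integralForms_iff hη hspan hh hh).mpr le_rfl
  · rintro _ ⟨f, hf, rfl, hfη⟩
    exact (inv_smul_smul_mem_integralForms_iff hη hspan hf hh).mp hfη

variable [Algebra k R] [IsScalarTower k R K] [PerfectField k] [Algebra.EssFiniteType k R] {n : ℕ}
  {ω : ExteriorAlgebra K Ω[K⁄k]}

theorem exists_irreducible_integralForms_eq_span (hn : Module.finrank K Ω[K⁄k] = n) :
    ∃ (x : Fin n → R) (i : Fin n), Irreducible (x i) ∧
      Submodule.span K (Set.range fun i => D k K (algebraMap R K (x i))) = ⊤ ∧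
      integralForms k R n =
        Submodule.span R {ιMulti K n fun i => D k K (algebraMap R K (x i))} := by
  obtain ⟨x, i, hi, hx⟩ := exists_irreducible_span_D_eq_top k R K hn
  exact ⟨x, i, hi, span_D_algebraMap_eq_top K hx, integralForms_eq_span_singleton hx⟩

variable (R) in
theorem exists_generator_integralForms (hn : Module.finrank K Ω[K⁄k] = n)
    (hω : ω ∈ ⋀[K]^n Ω[K⁄k]) :
    ∃ η ≠ 0, integralForms k R n = Submodule.span R {η} ∧ ∃ h : K, ω = h • η := by
  obtain ⟨x, -, -, hx, hspan⟩ := exists_irreducible_integralForms_eq_span (R := R) hn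
  exact ⟨_, ιMulti_ne_zero_of_span_eq_top hn hx, hspan, exists_eq_smul_ιMulti hx hω⟩

theorem formOrd_smul (hn : Module.finrank K Ω[K⁄k] = n) (hω : ω ∈ ⋀[K]^n Ω[K⁄k]) (h0 : ω ≠ 0)
    {c : K} (hc : c ≠ 0) : formOrd k R n (c • ω) = fracOrd R c + formOrd k R n ω := by
  obtain ⟨η, hη, hspan, h, rfl⟩ := exists_generator_integralForms R hn hω
  have hh : h ≠ 0 := left_ne_zero_of_smul h0
  rw [smul_smul, formOrd_smul_of_integralForms_eq_span hη hspan hh,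
    formOrd_smul_of_integralForms_eq_span hη hspan (mul_ne_zero hc hh), fracOrd_mul hc hh]

theorem le_formOrd (hn : Module.finrank K Ω[K⁄k] = n) (hω : ω ∈ ⋀[K]^n Ω[K⁄k]) (h0 : ω ≠ 0)
    {f : K} (hf : f ≠ 0) (hfω : f⁻¹ • ω ∈ integralForms k R n) :
    fracOrd R f ≤ formOrd k R n ω := by
  obtain ⟨η, hη, hspan, h, rfl⟩ := exists_generator_integralForms R hn hω
  have hh : h ≠ 0 := left_ne_zero_of_smul h0
  rw [formOrd_smul_of_integralForms_eq_span hη hspan hh]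
  exact (inv_smul_smul_mem_integralForms_iff hη hspan hf hh).mp hfω

end FormOrd

section RiemannHurwitz

theorem derivation_mul_pow_succ {k A M : Type*} [CommRing k] [CommRing A] [Algebra k A]
    [AddCommGroup M] [Module A M] [Module k M] (d : Derivation k A M) (u s : A) (m : ℕ) :
    d (u * s ^ (m + 1)) = s ^ m • (s • d u + ((m + 1 : ℕ) * u) • d s) := by
  rw [d.leibniz, d.leibniz_pow, Nat.add_sub_cancel, add_comm, ← Nat.cast_smul_eq_nsmul A]
  simp only [smul_add, smul_smul]
  ring_nf

theorem exists_integralForms_eq_pow_smul {k R K : Type u} [CommRing k] [CommRing R] [Algebra k R]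
    [Field K] [Algebra R K] [Algebra k K] [IsScalarTower k R K] {n : ℕ} {y : Fin n → R} {i : Fin n}
    {u s : R} {m : ℕ} (hy : y i = u * s ^ (m + 1)) :
    ∃ ζ ∈ integralForms k R n,
      ιMulti K n (fun j => D k K (algebraMap R K (y j))) = s ^ m • ζ := by
  let d : Derivation k R Ω[K⁄k] := (D k K).compAlgebraMap R
  let f := (ιMulti K (M := Ω[K⁄k]) n).toMultilinearMap.restrictScalars R
  have hmem : ∀ a : R, f (Function.update (d ∘ y) i (d a)) ∈ integralForms k R n := fun a => by
    rw [← Function.comp_update]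
    exact Submodule.subset_span ⟨Function.update y i a, rfl⟩
  refine ⟨f (Function.update (d ∘ y) i (s • d u + ((m + 1 : ℕ) * u) • d s)), ?_, ?_⟩
  · rw [f.map_update_add, f.map_update_smul, f.map_update_smul]
    exact add_mem (Submodule.smul_mem _ _ (hmem u)) (Submodule.smul_mem _ _ (hmem s))
  · rw [← f.map_update_smul, ← derivation_mul_pow_succ, ← hy]
    exact congrArg f (Function.update_eq_self i (d ∘ y)).symm

variable {k R K R' L : Type u} [Field k] [PerfectField k] [CommRing R] [IsDomain R]
  [IsDiscreteValuationRing R] [Algebra k R] [Algebra.EssFiniteType k R] [Field K] [Algebra R K]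
  [IsFractionRing R K] [Algebra k K] [IsScalarTower k R K] [CommRing R'] [IsDomain R']
  [IsDiscreteValuationRing R'] [Algebra k R'] [Algebra.EssFiniteType k R'] [Field L] [Algebra R' L]
  [IsFractionRing R' L] [Algebra k L] [IsScalarTower k R' L]

/-- Equality holds when the ramification is tame; wild ramification only increases the right-hand
side. -/
theorem mul_formOrd_add_one_le {φ : K →ₐ[k] L} (hφ : IsSeparableHom φ) {e : ℕ} (he : 0 < e)
    (hord : ∀ f, fracOrd R' (φ f) = e * fracOrd R f) {n : ℕ} (hn : Module.finrank K Ω[K⁄k] = n)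
    {ω : ExteriorAlgebra K Ω[K⁄k]} (hω : ω ∈ ⋀[K]^n Ω[K⁄k]) (h0 : ω ≠ 0) :
    e * (formOrd k R n ω + 1) ≤ formOrd k R' n (formPullback φ ω) + 1 := by
  have : Algebra.EssFiniteType k K := essFiniteType_fractionRing k R K
  obtain ⟨m, rfl⟩ : ∃ m, e = m + 1 := Nat.exists_eq_succ_of_ne_zero he.ne'
  obtain ⟨x, i, hi, hx, hspan⟩ := exists_irreducible_integralForms_eq_span (R := R) hn
  obtain ⟨h, rfl⟩ := exists_eq_smul_ιMulti hx hω
  have hh : h ≠ 0 := left_ne_zero_of_smul h0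
  have hη := right_ne_zero_of_smul h0
  obtain ⟨s, hs⟩ := IsDiscreteValuationRing.exists_irreducible R'
  have hs0 : algebraMap R' L s ≠ 0 := by simpa using hs.ne_zero
  have hφh : φ h ≠ 0 := (map_ne_zero φ).mpr hh
  have hxR' : ∀ j, ∃ y : R', algebraMap R' L y = φ (algebraMap R K (x j)) := fun j => by
    rw [← Set.mem_range, ← fracOrd_nonneg_iff, hord]
    exact mul_nonneg (Int.natCast_nonneg _) (fracOrd_nonneg_iff.mpr ⟨x j, rfl⟩)
  choose y hy using hxR'
  obtain ⟨u, hu⟩ : ∃ u, y i = u * s ^ (m + 1) := by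
    have hφx : φ (algebraMap R K (x i)) ≠ 0 := by simpa using hi.ne_zero
    obtain ⟨u, hu⟩ := (fracOrd_le_iff (R := R') hφx (pow_ne_zero (m + 1) hs0)).mp (by
      rw [hord, fracOrd_pow, fracOrd_irreducible hi, fracOrd_irreducible hs])
    exact ⟨u, IsFractionRing.injective R' L (by rw [hy, hu, map_mul, map_pow])⟩
  obtain ⟨ζ, hζ, hyζ⟩ := exists_integralForms_eq_pow_smul (k := k) (K := L) hu
  have hpull : ιMulti L n (fun j => D k L (φ (algebraMap R K (x j)))) =
      algebraMap R' L s ^ m • ζ := by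
    rw [← map_pow, algebraMap_smul, ← hyζ]
    simp only [hy]
  have hle : fracOrd R' (φ h * algebraMap R' L s ^ m) ≤ formOrd k R' n (formPullback φ _) :=
    le_formOrd ((finrank_kaehlerDifferential_eq_of_isSeparableHom hφ).trans hn)
      (formPullback_mem_exteriorPower φ hn hω) (formPullback_ne_zero hφ hn hω h0)
      (mul_ne_zero hφh (pow_ne_zero m hs0)) (by
        rwa [formPullback_smul, formPullback_ιMulti_D, hpull, smul_smul (φ h),
          inv_smul_smul₀ (mul_ne_zero hφh (pow_ne_zero m hs0))])
  rw [fracOrd_mul hφh (pow_ne_zero m hs0), hord, fracOrd_pow, fracOrd_irreducible hs] at hle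
  rw [formOrd_smul_of_integralForms_eq_span hη hspan hh]
  push_cast at hle ⊢
  linarith

end RiemannHurwitz

end Orders

/-! ### Normal noetherian domains in codimension one -/

section Hartogs

open IsLocalRing

section LocalRing

variable {B K : Type*} [CommRing B] [IsDomain B] [IsNoetherianRing B] [IsIntegrallyClosed B]
  [IsLocalRing B] [Field K] [Algebra B K] [IsFractionRing B K] {c : K}

theorem exists_mul_eq_one_of_forall_mul_mem_range
    (hc : c ∉ Set.range (algebraMap B K))
    (hmul : ∀ b ∈ maximalIdeal B, algebraMap B K b * c ∈ Set.range (algebraMap B K)) :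
    ∃ b ∈ maximalIdeal B, algebraMap B K b * c = 1 := by
  suffices h : ∃ b ∈ maximalIdeal B, ∃ u : Bˣ, algebraMap B K b * c = algebraMap B K u by
    obtain ⟨b, hb, u, hu⟩ := h
    refine ⟨b * ↑u⁻¹, Ideal.mul_mem_right _ _ hb, ?_⟩
    rw [map_mul, mul_right_comm, hu, ← map_mul, Units.mul_inv, map_one]
  by_contra! hnonunit
  refine hc (IsIntegrallyClosed.isIntegral_iff.mp (isIntegral_of_smul_mem_submodule
    (Submodule.map (Algebra.linearMap B K) (maximalIdeal B)) ?_
    ((IsNoetherian.noetherian (maximalIdeal B)).map _) c ?_))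
  · rw [ne_eq, (Submodule.map_injective_of_injective (IsFractionRing.injective B K)).eq_iff'
      (Submodule.map_bot _), ← isField_iff_maximalIdeal_eq]
    exact fun hB => hc ((IsFractionRing.surjective_iff_isField (R := B) (K := K)).mpr hB c)
  · rintro _ ⟨b, hb, rfl⟩
    obtain ⟨b', hb'⟩ := hmul b hb
    refine ⟨b', fun hu => hnonunit b hb hu.unit hb'.symm, ?_⟩
    rw [Algebra.linearMap_apply, hb', mul_comm]
    rfl

/-- The maximal ideal is the conductor of `c`, hence generated by `c⁻¹`. -/
theorem isDiscreteValuationRing_of_forall_mul_mem_range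
    (hc : c ∉ Set.range (algebraMap B K))
    (hmul : ∀ b ∈ maximalIdeal B, algebraMap B K b * c ∈ Set.range (algebraMap B K)) :
    IsDiscreteValuationRing B := by
  have hB : ¬IsField B := fun h =>
    hc ((IsFractionRing.surjective_iff_isField (R := B) (K := K)).mpr h c)
  obtain ⟨b, hb, hbc⟩ := exists_mul_eq_one_of_forall_mul_mem_range hc hmul
  refine ((IsDiscreteValuationRing.TFAE B hB).out 0 4).mpr ?_
  refine ⟨b, le_antisymm (fun a ha => ?_) ((Ideal.span_singleton_le_iff_mem _).mpr hb)⟩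
  obtain ⟨r, hr⟩ := hmul a ha
  refine Ideal.mem_span_singleton.mpr ⟨r, IsFractionRing.injective B K ?_⟩
  rw [map_mul, hr, mul_left_comm, hbc, mul_one]

end LocalRing

variable {A K : Type*} [CommRing A] [IsNoetherianRing A] [Field K] [Algebra A K]

theorem exists_prime_eq_conductor {f : K} (hf : f ∉ Set.range (algebraMap A K)) :
    ∃ (P : Ideal A) (c : K), P.IsPrime ∧
      (∀ a, a ∈ P ↔ algebraMap A K a * c ∈ Set.range (algebraMap A K)) ∧
      ∀ a, algebraMap A K a * f ∈ Set.range (algebraMap A K) → a ∈ P := by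
  let N : Submodule A K := LinearMap.range (Algebra.linearMap A K)
  have mem_colon (a : A) (c : K) : a ∈ (⊥ : Submodule A (K ⧸ N)).colon {N.mkQ c} ↔
      algebraMap A K a * c ∈ Set.range (algebraMap A K) := by
    rw [Submodule.mem_colon_singleton, Submodule.mem_bot, ← map_smul, Submodule.mkQ_apply,
      Submodule.Quotient.mk_eq_zero, Algebra.smul_def]
    rfl
  have hfN : N.mkQ f ≠ 0 := by
    rwa [ne_eq, Submodule.mkQ_apply, Submodule.Quotient.mk_eq_zero]
  obtain ⟨P, hP, hle⟩ := exists_le_isAssociatedPrime_of_isNoetherianRing A (N.mkQ f) hfN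
  obtain ⟨hprime, x, rfl⟩ := isAssociatedPrime_iff.mp hP
  obtain ⟨c, rfl⟩ := N.mkQ_surjective x
  exact ⟨_, c, hprime, fun a => mem_colon a c, fun a ha => hle ((mem_colon a f).mpr ha)⟩

/-- The algebraic Hartogs lemma, in contrapositive form. -/
theorem exists_prime_isDiscreteValuationRing_of_notMem_range [IsDomain A] [IsIntegrallyClosed A]
    [IsFractionRing A K] {f : K} (hf : f ∉ Set.range (algebraMap A K)) :
    ∃ (P : Ideal A) (_ : P.IsPrime), IsDiscreteValuationRing (Localization.AtPrime P) ∧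
      ∀ a, algebraMap A K a * f ∈ Set.range (algebraMap A K) → a ∈ P := by
  obtain ⟨P, c, hP, hPc, hPf⟩ := exists_prime_eq_conductor hf
  refine ⟨P, hP, ?_, hPf⟩
  let AP := Localization.AtPrime P
  have hle := P.primeCompl_le_nonZeroDivisors
  let : Algebra AP K := IsLocalization.localizationAlgebraOfSubmonoidLe AP K P.primeCompl _ hle
  have : IsScalarTower A AP K :=
    IsLocalization.localization_isScalarTower_of_submonoid_le AP K _ _ hle
  have : IsFractionRing AP K :=
    IsFractionRing.isFractionRing_of_isDomain_of_isLocalization P.primeCompl AP K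
  have : IsNoetherianRing AP := IsLocalization.isNoetherianRing P.primeCompl AP ‹_›
  have : IsIntegrallyClosed AP := isIntegrallyClosed_of_isLocalization AP P.primeCompl hle
  refine isDiscreteValuationRing_of_forall_mul_mem_range (c := c) ?_ fun m hm => ?_
  · rintro ⟨r, rfl⟩
    obtain ⟨⟨a, s⟩, has⟩ := IsLocalization.surj P.primeCompl r
    refine s.2 ((hPc s).mpr ⟨a, ?_⟩)
    rw [IsScalarTower.algebraMap_apply A AP K, ← has, map_mul, mul_comm,
      ← IsScalarTower.algebraMap_apply]
  · obtain ⟨a, s, rfl⟩ := IsLocalization.exists_mk'_eq P.primeCompl m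
    obtain ⟨b, hb⟩ := (hPc a).mp ((IsLocalization.AtPrime.mk'_mem_maximal_iff AP P a s).mp hm)
    refine ⟨IsLocalization.mk' AP b s, ?_⟩
    have hs : algebraMap A K s ≠ 0 := by simpa using nonZeroDivisors.ne_zero (hle s.2)
    refine mul_left_cancel₀ hs ?_
    rw [IsScalarTower.algebraMap_apply A AP K s, ← mul_assoc, ← map_mul, ← map_mul,
      IsLocalization.mk'_spec', IsLocalization.mk'_spec', ← IsScalarTower.algebraMap_apply,
      ← IsScalarTower.algebraMap_apply, hb]

end Hartogs

/-! ### Normal models of valuation rings -/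

section NormalModels

open IsLocalRing KaehlerDifferential

theorem exists_linearIndependent_add {K V : Type*} [DivisionRing K] [AddCommGroup V] [Module K V]
    {H : AddSubgroup V} (hH : Submodule.span K (H : Set V) = ⊤) {n : ℕ}
    (hn : n ≤ Module.finrank K V) (v : Fin n → V) :
    ∃ h : Fin n → V, (∀ i, h i ∈ H) ∧ LinearIndependent K (v + h) := by
  induction n with
  | zero => exact ⟨0, fun i => i.elim0, linearIndependent_empty_type⟩
  | succ n ih =>
    obtain ⟨h, hmem, hli⟩ := ih (by omega) (Fin.init v)
    set W := Submodule.span K (Set.range (Fin.init v + h)) with hW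
    have hWtop : W ≠ ⊤ := fun htop => by
      have := finrank_range_le_card (R := K) (Fin.init v + h)
      rw [Set.finrank, ← hW, htop, finrank_top, Fintype.card_fin] at this
      omega
    obtain ⟨a, haH, haW⟩ : ∃ a ∈ H, v (Fin.last n) + a ∉ W := by
      by_contra! hall
      refine hWtop (eq_top_iff.mpr (hH ▸ Submodule.span_le.mpr fun a ha => ?_))
      have hlast := hall 0 H.zero_mem
      rw [add_zero] at hlast
      simpa only [add_sub_cancel_left, SetLike.mem_coe] using W.sub_mem (hall a ha) hlast
    refine ⟨Fin.snoc h a, Fin.lastCases (by simpa using haH) (by simpa using hmem), ?_⟩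
    convert linearIndependent_finSnoc.mpr ⟨hli, haW⟩ using 1
    funext i
    refine Fin.lastCases ?_ (fun i => ?_) i <;> simp [Fin.init]

theorem span_D_maximalIdeal_eq_top {k R : Type*} (K : Type*) [CommRing k] [CommRing R]
    [IsLocalRing R] (hR : ¬ IsField R) [Algebra k R] [Field K] [Algebra R K] [IsFractionRing R K]
    [Algebra k K] [IsScalarTower k R K] :
    Submodule.span K ((fun a : R => D k K (algebraMap R K a)) '' maximalIdeal R) = ⊤ := by
  set W := Submodule.span K ((fun a : R => D k K (algebraMap R K a)) '' maximalIdeal R)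
  have hmem : ∀ a ∈ maximalIdeal R, D k K (algebraMap R K a) ∈ W := fun a ha =>
    Submodule.subset_span ⟨a, ha, rfl⟩
  obtain ⟨t, ht, ht0⟩ := Submodule.exists_mem_ne_zero_of_ne_bot
    (isField_iff_maximalIdeal_eq.not.mp hR)
  rw [eq_top_iff, ← span_D_algebraMap_eq_top (k := k) (R := R) K (x := id)
    (span_range_derivation k R), Submodule.span_le]
  rintro _ ⟨r, rfl⟩
  have htr := W.sub_mem (hmem (t * r) (Ideal.mul_mem_right _ _ ht))
    (W.smul_mem (algebraMap R K r) (hmem t ht))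
  rw [map_mul, Derivation.leibniz, add_sub_cancel_right] at htr
  exact (W.smul_mem_iff (by simpa using ht0)).mp htr

theorem formallyUnramified_of_span_D_eq_top {k F K ι : Type*} [CommRing k] [CommRing F] [CommRing K]
    [Algebra k F] [Algebra k K] [Algebra F K] [IsScalarTower k F K] {x : ι → F}
    (hx : Submodule.span K (Set.range fun i => D k K (algebraMap F K (x i))) = ⊤) :
    Algebra.FormallyUnramified F K := by
  have hzero : KaehlerDifferential.map k F K K = 0 := LinearMap.ext_on_range hx fun i => by
    rw [map_D, Algebra.algebraMap_self, RingHom.id_apply, Derivation.map_algebraMap,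
      LinearMap.zero_apply]
  rw [Algebra.formallyUnramified_iff]
  refine subsingleton_of_forall_eq 0 fun w => ?_
  obtain ⟨z, rfl⟩ := map_surjective k F K w
  rw [hzero, LinearMap.zero_apply]

theorem height_under_le_one_of_forall_isUnit {A R : Type*} [CommRing A] [IsNoetherianRing A]
    [CommRing R] [IsLocalRing R] [Algebra A R] [Algebra (Polynomial A) R]
    [IsScalarTower A (Polynomial A) R]
    (hA : ∀ a : A, a ≠ 0 → IsUnit (algebraMap A R a))
    (hX : algebraMap (Polynomial A) R Polynomial.X ∈ maximalIdeal R) :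
    ((maximalIdeal R).under (Polynomial A)).height ≤ 1 := by
  have : Nontrivial A := (algebraMap A R).domain_nontrivial
  refine le_trans (Ideal.height_mono fun p hp => Ideal.mem_span_singleton.mpr ?_)
    (Ideal.height_span_singleton_le_one (x := Polynomial.X) Polynomial.not_isUnit_X)
  rw [Polynomial.X_dvd_iff]
  by_contra h0
  rw [Ideal.mem_comap, ← Polynomial.divX_mul_X_add p, map_add, map_mul,
    Ideal.add_mem_iff_right _ (Ideal.mul_mem_left _ _ hX), ← Polynomial.algebraMap_eq,
    ← IsScalarTower.algebraMap_apply] at hp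
  exact hp (hA _ h0)

theorem height_le_height_under {A B : Type*} [CommRing A] [CommRing B] [Algebra A B]
    [Algebra.IsIntegral A B] (p : Ideal B) [hp : p.IsPrime] : p.height ≤ (p.under A).height := by
  have hmono : StrictMono (PrimeSpectrum.comap (algebraMap A B)) := fun _ _ h =>
    Ideal.IsIntegral.comap_lt_comap h
  have hle := Order.height_le_height_apply_of_strictMono _ hmono ⟨p, hp⟩
  rwa [← PrimeSpectrum.height_eq_orderHeight, ← PrimeSpectrum.height_eq_orderHeight] at hle

theorem valuationRing_localization_of_height_le_one {C : Type*} [CommRing C] [IsDomain C]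
    [IsNoetherianRing C] [IsIntegrallyClosed C] (p : Ideal C) [p.IsPrime] (hp : p.height ≤ 1) :
    ValuationRing (Localization.AtPrime p) := by
  set Cp := Localization.AtPrime p
  have : IsNoetherianRing Cp := IsLocalization.isNoetherianRing p.primeCompl Cp inferInstance
  have : IsIntegrallyClosed Cp :=
    isIntegrallyClosed_of_isLocalization Cp p.primeCompl p.primeCompl_le_nonZeroDivisors
  have : Ring.KrullDimLE 1 Cp := by
    rw [Ring.KrullDimLE, Order.krullDimLE_iff]
    change ringKrullDim Cp ≤ _
    rw [IsLocalization.AtPrime.ringKrullDim_eq_height p Cp]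
    exact_mod_cast hp
  have htfae : ValuationRing Cp ↔
      IsIntegrallyClosed Cp ∧ ∀ P : Ideal Cp, P ≠ ⊥ → P.IsPrime → P = maximalIdeal Cp :=
    (tfae_of_isNoetherianRing_of_isLocalRing_of_isDomain Cp).out 1 3
  exact htfae.mpr ⟨‹_›, fun Q hQ hQp => eq_maximalIdeal (hQp.isMaximal_of_ne_bot hQ)⟩

theorem isLocalization_atPrime_of_height_le_one {C R : Type*} (K : Type*) [CommRing C] [IsDomain C]
    [IsNoetherianRing C] [IsIntegrallyClosed C] [CommRing R] [IsDomain R] [ValuationRing R]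
    [Algebra C R] [Field K] [Algebra R K] [Algebra C K] [IsScalarTower C R K] [IsFractionRing C K]
    [IsFractionRing R K] (hC : ((maximalIdeal R).under C).height ≤ 1) :
    IsLocalization.AtPrime R ((maximalIdeal R).under C) := by
  set p := (maximalIdeal R).under C
  let Cp := Localization.AtPrime p
  have : ValuationRing Cp := valuationRing_localization_of_height_le_one p hC
  let f : Cp →ₐ[C] R := IsLocalization.liftAlgHom (M := p.primeCompl) (f := Algebra.ofId C R)
    fun s => not_not.mp s.2
  have hf : IsLocalHom (f : Cp →+* R) := ⟨fun a ha => by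
    obtain ⟨c, s, rfl⟩ := IsLocalization.exists_mk'_eq p.primeCompl a
    refine (IsLocalization.AtPrime.isUnit_mk'_iff Cp p c s).mpr fun hc => hc ?_
    have hs : IsUnit (f (algebraMap C Cp s)) := by rw [f.commutes]; exact not_not.mp s.2
    rw [← f.commutes, ← IsLocalization.mk'_spec Cp c s, map_mul]
    exact ha.mul hs⟩
  algebraize [(algebraMap R K).comp (f : Cp →+* R)]
  have : IsScalarTower C Cp K := .of_algebraMap_eq fun c =>
    (IsScalarTower.algebraMap_apply C R K c).trans (congrArg _ (f.commutes c).symm)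
  have := IsFractionRing.isFractionRing_of_isDomain_of_isLocalization p.primeCompl Cp K
  have hbij := bijective_rangeRestrict_comp_of_valuationRing (f : Cp →+* R) (algebraMap R K) rfl
  have hrange : Function.Bijective (algebraMap R K).rangeRestrict :=
    ⟨.of_comp (f := Subtype.val) (IsFractionRing.injective R K),
      (algebraMap R K).rangeRestrict_surjective⟩
  exact IsLocalization.isLocalization_of_algEquiv p.primeCompl
    (AlgEquiv.ofBijective f ((hrange.of_comp_iff' f).mp hbij))

section

variable {k R : Type*} [Field k] [CommRing R] [Algebra k R]

theorem isIntegralClosure_integralClosure (P R K : Type*) [CommRing P] [CommRing R]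
    [IsIntegrallyClosed R] [Algebra P R] [CommRing K] [Algebra R K] [IsFractionRing R K]
    [Algebra P K] [IsScalarTower P R K] : IsIntegralClosure (integralClosure P R) P K where
  algebraMap_injective := (IsFractionRing.injective R K).comp Subtype.val_injective
  isIntegral_iff {z} := by
    refine ⟨fun hz => ?_, fun ⟨c, hc⟩ => hc ▸ c.2.algebraMap⟩
    obtain ⟨r, rfl⟩ := IsIntegrallyClosed.isIntegral_iff.mp (hz.tower_top (A := R))
    exact ⟨⟨r, (isIntegral_algebraMap_iff (IsFractionRing.injective R K)).mp hz⟩, rfl⟩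

/-- `B` is a normal model of the local `k`-algebra `R`: the local ring of the normal affine variety
`Spec B` at the centre of `R` on it, i.e. at the prime of `B` under the maximal ideal of `R`, is
`R`. -/
structure IsNormalModel [IsLocalRing R] (B : Subalgebra k R) : Prop where
  fg : B.FG
  isIntegrallyClosed : IsIntegrallyClosed B
  isLocalization : IsLocalization.AtPrime R ((maximalIdeal R).under B)

theorem isNormalModel_integralClosure [IsDomain R] [ValuationRing R] (P K : Type*) {ι : Type*}
    [CommRing P] [Algebra k P] [Algebra.FiniteType k P] [IsIntegrallyClosed P] [Algebra P R]
    [FaithfulSMul P R] [IsScalarTower k P R] [Field K] [Algebra R K] [IsFractionRing R K]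
    [Algebra k K] [IsScalarTower k R K] [Algebra.EssFiniteType k K] {x : ι → P}
    (hx : Submodule.span K (Set.range fun i => D k K (algebraMap R K (algebraMap P R (x i)))) = ⊤)
    (hP : ((maximalIdeal R).under P).height ≤ 1) :
    IsNormalModel ((integralClosure P R).restrictScalars k) := by
  let C := integralClosure P R
  have : IsDomain P := (FaithfulSMul.algebraMap_injective P R).isDomain
  have : IsNoetherianRing P := Algebra.FiniteType.isNoetherianRing k P
  algebraize [(algebraMap R K).comp (algebraMap P R)]
  have : FaithfulSMul P K := .trans P R K
  let F := FractionRing P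
  let : Algebra F K := FractionRing.liftAlgebra P K
  have : IsScalarTower k P K := .of_algebraMap_eq fun a => by
    rw [IsScalarTower.algebraMap_apply P R K, ← IsScalarTower.algebraMap_apply k P R,
      ← IsScalarTower.algebraMap_apply]
  have : IsScalarTower k F K := .to₁₃₄ k P F K
  have : Algebra.FormallyUnramified F K :=
    formallyUnramified_of_span_D_eq_top (k := k) (x := fun i => algebraMap P F (x i))
      (by simpa only [← IsScalarTower.algebraMap_apply] using hx)
  have : Algebra.EssFiniteType F K := .of_comp k F K
  have : Algebra.IsSeparable F K := Algebra.FormallyUnramified.isSeparable F K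
  have : Module.Finite F K := Algebra.FormallyUnramified.finite_of_free F K
  have : IsScalarTower C R K := .of_algebraMap_eq fun _ => rfl
  have : IsIntegralClosure C P K := isIntegralClosure_integralClosure P R K
  have : Module.Finite P C := IsIntegralClosure.finite P F K C
  have : IsFractionRing C K := IsIntegralClosure.isFractionRing_of_finite_extension P F K C
  have : IsIntegrallyClosed C := (isIntegrallyClosed_iff_isIntegrallyClosedIn K).mpr
    (IsIntegrallyClosedIn.of_isIntegralClosure P)
  have : IsNoetherianRing C := .of_finite P C
  have hC : ((maximalIdeal R).under C).height ≤ 1 := (height_le_height_under (A := P) _).trans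
    (by rwa [Ideal.under_under])
  have hloc := isLocalization_atPrime_of_height_le_one (R := R) K hC
  have : IsScalarTower k P C := .of_algebraMap_eq fun a =>
    Subtype.ext (IsScalarTower.algebraMap_apply k P R a)
  have : Algebra.FiniteType k C := .trans (S := P) ‹_› inferInstance
  exact ⟨(Subalgebra.fg_iff_finiteType _).mpr this, ‹_›, hloc⟩

theorem isLocalization_atPrime_of_le [IsLocalRing R] {B C : Subalgebra k R} (hBC : B ≤ C)
    [IsLocalization.AtPrime R ((maximalIdeal R).under B)] :
    IsLocalization.AtPrime R ((maximalIdeal R).under C) where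
  map_units c := not_not.mp c.2
  surj r := by
    obtain ⟨⟨b, s⟩, hbs⟩ := IsLocalization.surj (M := ((maximalIdeal R).under B).primeCompl) r
    exact ⟨⟨⟨b, hBC b.2⟩, ⟨⟨s.1, hBC s.1.2⟩, s.2⟩⟩, hbs⟩
  exists_of_eq h := ⟨1, by rw [Subtype.val_injective h]⟩

theorem IsNormalModel.exists_le [IsDomain R] [IsLocalRing R] {B D : Subalgebra k R}
    (hB : IsNormalModel B) (hD : D.FG) : ∃ C : Subalgebra k R, IsNormalModel C ∧ D ≤ C := by
  obtain ⟨S, rfl⟩ := hD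
  have := hB.isIntegrallyClosed
  have := hB.isLocalization
  obtain ⟨d, hd⟩ := IsLocalization.exist_integer_multiples_of_finset
    ((maximalIdeal R).under B).primeCompl S
  have hdR : ∀ y : Submonoid.powers (d : B), IsUnit (Algebra.ofId B R y) := by
    rintro ⟨_, m, rfl⟩
    exact map_pow (Algebra.ofId B R) _ m ▸ (not_not.mp d.2 : IsUnit (algebraMap B R d)).pow m
  have hpow : Submonoid.powers (d : B) ≤ nonZeroDivisors B :=
    (Submonoid.powers_le.mpr d.2).trans (Ideal.primeCompl_le_nonZeroDivisors _)
  let f : Localization.Away (d : B) →ₐ[B] R := IsLocalization.liftAlgHom hdR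
  have hf : Function.Injective f := (IsLocalization.lift_injective_iff hdR).mpr fun x y =>
    (IsLocalization.injective _ hpow).eq_iff.trans Subtype.val_injective.eq_iff.symm
  have hrange : IsLocalization.Away (d : B) f.range :=
    IsLocalization.isLocalization_of_algEquiv _ (AlgEquiv.ofInjective f hf)
  refine ⟨f.range.restrictScalars k, ⟨?_, ?_, ?_⟩, Algebra.adjoin_le fun s hs => ?_⟩
  · have : Algebra.FiniteType k B := (Subalgebra.fg_iff_finiteType _).mp hB.fg
    have : Algebra.FiniteType B f.range :=
      IsLocalization.finiteType_of_monoid_fg (.powers (d : B)) _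
    have : IsScalarTower k B f.range := .of_algebraMap_eq fun a => rfl
    have : Algebra.FiniteType k f.range := .trans (S := B) ‹_› ‹_›
    exact (Subalgebra.fg_iff_finiteType _).mpr this
  · exact isIntegrallyClosed_of_isLocalization f.range (.powers (d : B)) hpow
  · exact isLocalization_atPrime_of_le fun b hb => f.range.algebraMap_mem ⟨b, hb⟩
  · obtain ⟨b, hb⟩ := hd s hs
    exact ⟨IsLocalization.mk' _ b ⟨d, Submonoid.mem_powers _⟩,
      (IsLocalization.lift_mk'_spec _ _ _ _).mpr (hb.trans (Algebra.smul_def _ _))⟩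

theorem exists_linearIndependent_D_of_residue [IsLocalRing R] (K : Type*) [Field K] [Algebra R K]
    [IsFractionRing R K] [Algebra k K] [IsScalarTower k R K] (hR : ¬ IsField R) {n : ℕ}
    (hn : n ≤ Module.finrank K Ω[K⁄k]) (x : Fin n → R) :
    ∃ y : Fin n → R, (∀ i, residue R (y i) = residue R (x i)) ∧
      LinearIndependent K fun i => D k K (algebraMap R K (y i)) := by
  let δ : R →+ Ω[K⁄k] := (D k K).toLinearMap.toAddMonoidHom.comp (algebraMap R K).toAddMonoidHom
  let H : AddSubgroup Ω[K⁄k] := (maximalIdeal R).toAddSubgroup.map δ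
  obtain ⟨h, hH, hli⟩ :=
    exists_linearIndependent_add (H := H) (span_D_maximalIdeal_eq_top K hR) hn (δ ∘ x)
  choose m hm hmh using hH
  refine ⟨x + m, fun i => ?_, ?_⟩
  · rw [Pi.add_apply, map_add, (residue_eq_zero_iff _).mpr (hm i), add_zero]
  · convert hli using 1
    exact funext fun i => (map_add δ (x i) (m i)).trans (congrArg _ (hmh i))

theorem exists_isNormalModel [IsDomain R] [ValuationRing R] (K : Type*) [Field K] [Algebra R K]
    [IsFractionRing R K] [Algebra k K] [IsScalarTower k R K] [Algebra.EssFiniteType k K]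
    (hR : ¬ IsField R) {n : ℕ} {x : Fin n → R}
    (hx : AlgebraicIndependent k fun i => residue R (x i))
    (hn : Module.finrank K Ω[K⁄k] = n + 1) : ∃ B : Subalgebra k R, IsNormalModel B := by
  obtain ⟨y, hyx, hli⟩ :=
    exists_linearIndependent_D_of_residue K hR hn.ge (Fin.snoc (α := fun _ => R) x 0)
  let A := MvPolynomial (Fin n) k
  algebraize [((MvPolynomial.aeval fun i => y i.castSucc : A →ₐ[k] R) : A →+* R)]
  algebraize [((Polynomial.aeval (y (Fin.last n)) : Polynomial A →ₐ[A] R) : Polynomial A →+* R)]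
  have hA : ∀ a : A, a ≠ 0 → IsUnit (algebraMap A R a) := fun a ha =>
    isUnit_aeval_of_algebraicIndependent_residue (by simpa [hyx] using hx) ha
  have hX : y (Fin.last n) ∈ maximalIdeal R := by
    rw [← residue_eq_zero_iff, hyx, Fin.snoc_last, map_zero]
  have hy0 : y (Fin.last n) ≠ 0 := fun h => hli.ne_zero (Fin.last n) (by simp [h])
  have : FaithfulSMul (Polynomial A) R := (faithfulSMul_iff_algebraMap_injective _ _).mpr <|
    transcendental_iff_injective.mp (transcendental_of_forall_isUnit hA hy0 hX)
  have : IsScalarTower A (Polynomial A) R := .of_algebraMap_eq fun a =>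
    (Polynomial.aeval_C (y (Fin.last n)) a).symm
  have : IsScalarTower k (Polynomial A) R := .of_algebraMap_eq fun a => by
    rw [IsScalarTower.algebraMap_apply k A (Polynomial A), ← IsScalarTower.algebraMap_apply A]
    exact (AlgHom.commutes (MvPolynomial.aeval fun i => y i.castSucc : A →ₐ[k] R) a).symm
  let X : Fin (n + 1) → Polynomial A :=
    Fin.snoc (α := fun _ => Polynomial A) (fun i => .C (.X i)) .X
  have hy : ∀ i, algebraMap (Polynomial A) R (X i) = y i := Fin.lastCases
    (by simp [X, RingHom.algebraMap_toAlgebra]) fun i => by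
      rw [show X i.castSucc = algebraMap A (Polynomial A) (.X i) from Fin.snoc_castSucc ..,
        ← IsScalarTower.algebraMap_apply]
      exact MvPolynomial.aeval_X _ i
  refine ⟨_, isNormalModel_integralClosure (Polynomial A) K (x := X) ?_
    (height_under_le_one_of_forall_isUnit hA ?_)⟩
  · simpa only [hy] using hli.span_eq_top_of_card_eq_finrank' (by simp [hn])
  · simpa [RingHom.algebraMap_toAlgebra] using hX

end

theorem exists_forall_dvd {ι R : Type*} [CommRing R] [IsDomain R] [ValuationRing R]
    {s : Finset ι} (hs : s.Nonempty) (f : ι → R) : ∃ i ∈ s, ∀ j ∈ s, f i ∣ f j := by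
  classical
  induction hs using Finset.Nonempty.cons_induction with
  | singleton a => exact ⟨a, by simp⟩
  | cons a s h _ ih =>
    obtain ⟨i, hi, hij⟩ := ih
    rcases ValuationRing.dvd_total (f i) (f a) with hia | hai
    · exact ⟨i, by simp [hi], by simpa [hia] using hij⟩
    · exact ⟨a, by simp, by simpa using fun j hj => hai.trans (hij j hj)⟩

theorem exists_coeff_eq_one_of_isAlgebraic {R A : Type*} [CommRing R] [IsDomain R] [ValuationRing R]
    [CommRing A] [IsDomain A] [Algebra R A] [FaithfulSMul R A] {w : A} (hw : IsAlgebraic R w) :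
    ∃ (q : Polynomial R) (i : ℕ), q.coeff i = 1 ∧ Polynomial.aeval w q = 0 := by
  obtain ⟨p, hp, hpw⟩ := hw
  obtain ⟨i, hi, hdvd⟩ := exists_forall_dvd (Polynomial.support_nonempty.mpr hp) p.coeff
  have hi0 : p.coeff i ≠ 0 := Polynomial.mem_support_iff.mp hi
  obtain ⟨q, hq⟩ : Polynomial.C (p.coeff i) ∣ p :=
    (Polynomial.C_dvd_iff_dvd_coeff _ _).mpr fun j => by
      by_cases hj : p.coeff j = 0
      · exact hj ▸ dvd_zero _
      · exact hdvd j (Polynomial.mem_support_iff.mpr hj)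
  refine ⟨q, i, mul_left_cancel₀ hi0 ?_, ?_⟩
  · rw [mul_one, ← Polynomial.coeff_C_mul, ← hq]
  · rw [hq, map_mul, Polynomial.aeval_C] at hpw
    exact (mul_eq_zero.mp hpw).resolve_left
      ((map_ne_zero_iff _ (FaithfulSMul.algebraMap_injective R A)).mpr hi0)

theorem isAlgebraic_residueField {R R' : Type*} [CommRing R] [IsDomain R] [ValuationRing R]
    [CommRing R'] [IsDomain R'] [IsLocalRing R'] [Algebra R R'] [IsLocalHom (algebraMap R R')]
    [FaithfulSMul R R'] [Algebra.IsAlgebraic R R'] :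
    Algebra.IsAlgebraic (ResidueField R) (ResidueField R') := by
  refine ⟨fun w => ?_⟩
  obtain ⟨w, rfl⟩ := residue_surjective w
  obtain ⟨q, i, hqi, hqw⟩ := exists_coeff_eq_one_of_isAlgebraic
    (Algebra.IsAlgebraic.isAlgebraic (R := R) w)
  refine ⟨q.map (residue R), fun h => ?_, ?_⟩
  · simpa [hqi] using congrArg (fun r => r.coeff i) h
  · have hres := congrArg (residue R') hqw
    rw [map_zero, Polynomial.aeval_def, Polynomial.hom_eval₂] at hres
    rw [Polynomial.aeval_def, Polynomial.eval₂_map]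
    exact hres

theorem trdeg_residueField_eq {k R R' : Type u} [Field k] [CommRing R] [IsDomain R]
    [ValuationRing R] [CommRing R'] [IsDomain R'] [IsLocalRing R'] [Algebra k R] [Algebra k R']
    [Algebra R R'] [IsScalarTower k R R'] [IsLocalHom (algebraMap R R')] [FaithfulSMul R R']
    [Algebra.IsAlgebraic R R'] :
    Algebra.trdeg k (ResidueField R) = Algebra.trdeg k (ResidueField R') := by
  have : Algebra.IsAlgebraic (ResidueField R) (ResidueField R') := isAlgebraic_residueField
  have : FaithfulSMul (ResidueField R) (ResidueField R') :=
    (faithfulSMul_iff_algebraMap_injective _ _).mpr (RingHom.injective _)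
  have : IsScalarTower k (ResidueField R) (ResidueField R') :=
    .of_algebraMap_eq fun a => congrArg (residue R') (IsScalarTower.algebraMap_apply k R R' a)
  rw [← trdeg_add_eq k (ResidueField R) (A := ResidueField R'),
    trdeg_eq_zero (R := ResidueField R), add_zero]

theorem IsNormalModel.isDiscreteValuationRing {k R : Type*} [Field k] [CommRing R] [Algebra k R]
    [IsDomain R] [ValuationRing R] {B : Subalgebra k R} (hB : IsNormalModel B) (hR : ¬ IsField R) :
    IsDiscreteValuationRing R := by
  have : Algebra.FiniteType k B := (Subalgebra.fg_iff_finiteType _).mp hB.fg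
  have : IsNoetherianRing B := Algebra.FiniteType.isNoetherianRing k B
  have := hB.isLocalization
  have : IsNoetherianRing R :=
    IsLocalization.isNoetherianRing ((maximalIdeal R).under B).primeCompl R ‹_›
  exact ((IsDiscreteValuationRing.TFAE R hR).out 0 1).mpr ‹_›

end NormalModels

/-! ### Restriction of a divisorial valuation to a subfield -/

section RestrictedValuation

open IsLocalRing KaehlerDifferential

variable {k K L : Type u} [Field k] [Field K] [Algebra k K] [Field L] [Algebra k L]
  (φ : K →ₐ[k] L) (R' : Type u) [CommRing R'] [Algebra k R'] [Algebra R' L] [IsScalarTower k R' L]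

/-- The subring `φ⁻¹(R')` of `K`, for an extension of fields `φ : K → L` and a ring `R'` with
fraction field `L`. When `R'` is a valuation ring of `L`, this is the valuation ring of the
restriction of the valuation to `K`. -/
def comapRing : Subalgebra k K := (IsScalarTower.toAlgHom k R' L).range.comap φ

namespace comapRing

variable {R'} in
theorem mem_iff {f : K} : f ∈ comapRing φ R' ↔ φ f ∈ Set.range (algebraMap R' L) := Iff.rfl

section

variable [IsFractionRing R' L]

noncomputable instance : Algebra (comapRing φ R') R' :=
  ((AlgEquiv.ofInjective (IsScalarTower.toAlgHom k R' L)
    (IsFractionRing.injective R' L)).symm.toAlgHom.comp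
    ((φ.comp (comapRing φ R').val).codRestrict _ fun v => v.2)).toRingHom.toAlgebra

instance : IsScalarTower k (comapRing φ R') R' :=
  .of_algebraMap_eq fun a => (AlgHom.commutes ((AlgEquiv.ofInjective (IsScalarTower.toAlgHom k R' L)
    (IsFractionRing.injective R' L)).symm.toAlgHom.comp
    ((φ.comp (comapRing φ R').val).codRestrict _ fun v => v.2)) a).symm

theorem algebraMap_algebraMap (v : comapRing φ R') :
    algebraMap R' L (algebraMap (comapRing φ R') R' v) = φ v :=
  congrArg Subtype.val (AlgEquiv.apply_symm_apply (AlgEquiv.ofInjective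
    (IsScalarTower.toAlgHom k R' L) (IsFractionRing.injective R' L)) _)

theorem algebraMap_injective : Function.Injective (algebraMap (comapRing φ R') R') := fun v w h =>
  Subtype.ext (φ.injective
    ((algebraMap_algebraMap φ R' v).symm.trans (h ▸ algebraMap_algebraMap φ R' w)))

instance : FaithfulSMul (comapRing φ R') R' :=
  (faithfulSMul_iff_algebraMap_injective _ _).mpr (algebraMap_injective φ R')

instance : IsLocalHom (algebraMap (comapRing φ R') R') where
  map_nonunit v hv := by
    obtain ⟨w, hw⟩ := isUnit_iff_exists_inv.mp hv
    have hφ : φ v * algebraMap R' L w = 1 := by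
      rw [← algebraMap_algebraMap φ R', ← map_mul, hw, map_one]
    have hmem : (v : K)⁻¹ ∈ comapRing φ R' :=
      (mem_iff φ).mpr ⟨w, by rw [map_inv₀]; exact eq_inv_of_mul_eq_one_right hφ⟩
    exact .of_mul_eq_one ⟨_, hmem⟩
      (Subtype.ext (mul_inv_cancel₀ fun h0 => by simp [h0] at hφ))

end

section

variable [IsDomain R'] [ValuationRing R'] [IsFractionRing R' L]

theorem mem_or_inv_mem (f : K) : f ∈ comapRing φ R' ∨ f⁻¹ ∈ comapRing φ R' := by
  simp only [mem_iff, map_inv₀]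
  exact ValuationRing.isInteger_or_isInteger R' (φ f)

instance : ValuationRing (comapRing φ R') :=
  inferInstanceAs (ValuationRing
    (ValuationSubring.mk (comapRing φ R').toSubring (mem_or_inv_mem φ R')))

instance : IsFractionRing (comapRing φ R') K :=
  inferInstanceAs (IsFractionRing
    (ValuationSubring.mk (comapRing φ R').toSubring (mem_or_inv_mem φ R')) K)

variable {φ}

theorem isAlgebraic (hφ : IsSeparableHom φ) : Algebra.IsAlgebraic (comapRing φ R') R' where
  isAlgebraic w := by
    let := φ.toRingHom.toAlgebra
    have : Algebra.IsSeparable K L := hφ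
    have : IsScalarTower (comapRing φ R') K L := .of_algebraMap_eq fun _ => rfl
    have : IsScalarTower (comapRing φ R') R' L :=
      .of_algebraMap_eq fun v => (algebraMap_algebraMap φ R' v).symm
    rw [← isAlgebraic_algebraMap_iff (A := L) (IsFractionRing.injective R' L),
      IsFractionRing.isAlgebraic_iff (comapRing φ R') K L]
    exact Algebra.IsAlgebraic.isAlgebraic _

end

variable [IsDomain R'] [IsDiscreteValuationRing R'] [IsFractionRing R' L] {φ}

theorem not_isField (hφ : IsSeparableHom φ) : ¬ IsField (comapRing φ R') := fun hfield => by
  have := isAlgebraic R' hφ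
  obtain ⟨t, ht⟩ := IsDiscreteValuationRing.exists_irreducible R'
  refine transcendental_of_forall_isUnit (A := comapRing φ R') (fun a ha => ?_) ht.ne_zero
    ht.not_isUnit (Algebra.IsAlgebraic.isAlgebraic t)
  obtain ⟨b, hb⟩ := hfield.mul_inv_cancel ha
  exact (IsUnit.of_mul_eq_one b hb).map _

variable [PerfectField k] [Algebra.EssFiniteType k R']

theorem finrank_kaehlerDifferential_eq (hφ : IsSeparableHom φ) :
    (Module.finrank K Ω[K⁄k] : Cardinal) =
      Algebra.trdeg k (ResidueField (comapRing φ R')) + 1 := by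
  have := isAlgebraic R' hφ
  have : Algebra.EssFiniteType k L := essFiniteType_fractionRing k R' L
  rw [← finrank_kaehlerDifferential_eq_of_isSeparableHom hφ, ← trdeg_eq_finrank_kaehlerDifferential,
    ← trdeg_residueField_add_one k R' L,
    trdeg_residueField_eq (R := comapRing φ R') (R' := R')]

variable [Algebra.EssFiniteType k K]

theorem exists_isNormalModel (hφ : IsSeparableHom φ) :
    ∃ B : Subalgebra k (comapRing φ R'), IsNormalModel B := by
  obtain ⟨n, hn⟩ : ∃ n : ℕ, Algebra.trdeg k (ResidueField (comapRing φ R')) = n :=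
    Cardinal.lt_aleph0.mp ((self_le_add_right _ 1).trans_lt
      (finrank_kaehlerDifferential_eq R' hφ ▸ Cardinal.natCast_lt_aleph0))
  obtain ⟨s, hs⟩ := exists_isTranscendenceBasis k (ResidueField (comapRing φ R'))
  have hcard : Cardinal.mk s = n := hs.cardinalMk_eq_trdeg.trans hn
  have : Finite s := Cardinal.lt_aleph0_iff_finite.mp (hcard ▸ Cardinal.natCast_lt_aleph0)
  have hcard' : Nat.card s = n := by rw [Nat.card, hcard, Cardinal.toNat_natCast]
  let e : Fin n ≃ s := (Finite.equivFinOfCardEq hcard').symm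
  choose x hx using fun i => residue_surjective (R := comapRing φ R') (e i)
  refine _root_.exists_isNormalModel K (not_isField R' hφ) (x := x) ?_ ?_
  · rw [funext hx]
    exact hs.1.comp e e.injective
  · exact_mod_cast (finrank_kaehlerDifferential_eq R' hφ).trans (congrArg (· + 1) hn)

theorem isDiscreteValuationRing (hφ : IsSeparableHom φ) :
    IsDiscreteValuationRing (comapRing φ R') := by
  obtain ⟨B, hB⟩ := exists_isNormalModel R' hφ
  exact hB.isDiscreteValuationRing (not_isField R' hφ)

end comapRing

end RestrictedValuation

/-! ### Local rings of normal varieties -/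

namespace NormalVariety

variable {k : Type u} [Field k]

noncomputable instance (X : NormalVariety k) (x : X.toScheme) :
    Algebra k (X.toScheme.presheaf.stalk x) :=
  (X.scalars ≫ X.toScheme.presheaf.germ ⊤ x (TopologicalSpace.Opens.mem_top _)).hom.toAlgebra

instance (X : NormalVariety k) (x : X.toScheme) :
    IsScalarTower k (X.toScheme.presheaf.stalk x) X.FunctionField := by
  refine .of_algebraMap_eq' ?_
  change (X.scalars ≫ X.toScheme.presheaf.germ ⊤ (genericPoint X.toScheme) _).hom =
    ((X.scalars ≫ X.toScheme.presheaf.germ ⊤ x _) ≫ X.toScheme.presheaf.stalkSpecializes _).hom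
  rw [Category.assoc, TopCat.Presheaf.germ_stalkSpecializes]

noncomputable instance (X : NormalVariety k) (U : X.toScheme.Opens) : Algebra k Γ(X.toScheme, U) :=
  (X.scalars ≫ X.toScheme.presheaf.map (homOfLE le_top).op).hom.toAlgebra

theorem ofHom_algebraMap_section (X : NormalVariety k) (U : X.toScheme.Opens) :
    CommRingCat.ofHom (algebraMap k Γ(X.toScheme, U)) =
      (Scheme.ΓSpecIso (CommRingCat.of k)).inv ≫ X.str.appLE ⊤ U le_top := by
  change X.scalars ≫ _ = _
  rw [scalars, Category.assoc]
  rfl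

theorem germ_algebraMap (X : NormalVariety k) {U : X.toScheme.Opens} {x : X.toScheme} (hx : x ∈ U)
    (a : k) : X.toScheme.presheaf.germ U x hx (algebraMap k Γ(X.toScheme, U) a) =
      algebraMap k (X.toScheme.presheaf.stalk x) a := by
  have h : (X.scalars ≫ X.toScheme.presheaf.map (homOfLE le_top).op) ≫
      X.toScheme.presheaf.germ U x hx =
      X.scalars ≫ X.toScheme.presheaf.germ ⊤ x (TopologicalSpace.Opens.mem_top _) := by
    rw [Category.assoc, TopCat.Presheaf.germ_res]
  exact congrArg (·.hom a) h

instance (X : NormalVariety k) (U : X.toScheme.Opens) [Nonempty U] :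
    IsScalarTower k Γ(X.toScheme, U) X.FunctionField :=
  .of_algebraMap_eq fun a => (X.germ_algebraMap _ a).symm

theorem finiteType_section (X : NormalVariety k) {U : X.toScheme.Opens} (hU : IsAffineOpen U) :
    Algebra.FiniteType k Γ(X.toScheme, U) := by
  have := X.locallyOfFiniteType
  rw [← RingHom.finiteType_algebraMap,
    ← CommRingCat.hom_ofHom (algebraMap k Γ(X.toScheme, U)), ofHom_algebraMap_section,
    CommRingCat.hom_comp]
  exact (LocallyOfFiniteType.finiteType_appLE X.str (isAffineOpen_top _) hU le_top).comp
    (.of_surjective _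
      (ConcreteCategory.bijective_of_isIso (Scheme.ΓSpecIso (CommRingCat.of k)).inv).2)

theorem exists_isAffineOpen (X : NormalVariety k) {U : X.toScheme.Opens} {x : X.toScheme}
    (hx : x ∈ U) : ∃ W : X.toScheme.Opens, IsAffineOpen W ∧ x ∈ W ∧ W ≤ U := by
  obtain ⟨_, ⟨W, hW, rfl⟩, hxW, hWU⟩ :=
    X.toScheme.isBasis_affineOpens.exists_subset_of_mem_open hx U.isOpen
  exact ⟨W, hW, hxW, hWU⟩

instance (X : NormalVariety k) (x : X.toScheme) :
    Algebra.EssFiniteType k (X.toScheme.presheaf.stalk x) := by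
  obtain ⟨U, hU, hxU, -⟩ := X.exists_isAffineOpen (TopologicalSpace.Opens.mem_top x)
  have := X.finiteType_section hU
  let := X.toScheme.presheaf.algebra_section_stalk ⟨x, hxU⟩
  have : IsScalarTower k Γ(X.toScheme, U) (X.toScheme.presheaf.stalk x) :=
    .of_algebraMap_eq fun a => (X.germ_algebraMap hxU a).symm
  have := hU.isLocalization_stalk ⟨x, hxU⟩
  have : Algebra.EssFiniteType Γ(X.toScheme, U) (X.toScheme.presheaf.stalk x) :=
    .of_isLocalization _ (hU.primeIdealOf ⟨x, hxU⟩).asIdeal.primeCompl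
  exact .comp k Γ(X.toScheme, U) _

instance (X : NormalVariety k) : Algebra.EssFiniteType k X.FunctionField :=
  inferInstanceAs (Algebra.EssFiniteType k (X.toScheme.presheaf.stalk (genericPoint X.toScheme)))

theorem isDiscreteValuationRing_stalk_iff (X : NormalVariety k) (x : X.toScheme) :
    IsDiscreteValuationRing (X.toScheme.presheaf.stalk x) ↔ Order.coheight x = 1 := by
  have hdim := ringKrullDim_stalk_eq_coheight x
  refine ⟨fun _ => ?_, fun hx => ?_⟩
  · rw [IsDiscreteValuationRing.ringKrullDim_eq_one] at hdim
    exact_mod_cast hdim.symm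
  · have hnf : ¬ IsField (X.toScheme.presheaf.stalk x) := fun hf => by
      simp [ringKrullDim_eq_zero_of_isField hf, hx] at hdim
    have hprime := Ring.krullDimLE_one_iff_of_noZeroDivisors.mp (krullDimLE_of_coheight_le hx.le)
    apply ((IsDiscreteValuationRing.TFAE _ hnf).out 0 3).mpr
    exact ⟨X.isIntegrallyClosed_stalk x, IsLocalRing.maximalIdeal _,
      ⟨IsLocalRing.isField_iff_maximalIdeal_eq.not.mp hnf, inferInstance⟩,
      fun P hP => IsLocalRing.eq_maximalIdeal (hprime P hP.1 hP.2)⟩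

instance (X : NormalVariety k) (E : X.PrimeDivisor) :
    IsDiscreteValuationRing (X.toScheme.presheaf.stalk E.1) :=
  (X.isDiscreteValuationRing_stalk_iff E.1).mpr E.2

theorem ord_eq_fracOrd (X : NormalVariety k) (f : X.FunctionField) (E : X.PrimeDivisor) :
    X.ord f E = fracOrd (X.toScheme.presheaf.stalk E.1) f := by
  rw [ord, Scheme.ord_eq_ordHom_of_coheight_eq_one E.2]
  rfl

theorem ordForm_eq_formOrd (X : NormalVariety k) (ω : X.RationalForm) (E : X.PrimeDivisor) :
    X.ordForm ω E = formOrd k (X.toScheme.presheaf.stalk E.1) X.topDegree ω := by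
  simp only [ordForm, ord_eq_fracOrd]
  rfl

theorem exists_isLocalization_stalk (X : NormalVariety k) {W : X.toScheme.Opens}
    (hW : IsAffineOpen W) (P : Ideal Γ(X.toScheme, W)) [hP : P.IsPrime] :
    ∃ x : W, letI := X.toScheme.presheaf.algebra_section_stalk x
      IsLocalization.AtPrime (X.toScheme.presheaf.stalk x.1) P :=
  have hx : hW.fromSpec ⟨P, hP⟩ ∈ W := hW.range_fromSpec.le ⟨_, rfl⟩
  ⟨⟨_, hx⟩, hW.isLocalization_stalk' ⟨P, hP⟩ hx⟩

theorem isIntegrallyClosed_section (X : NormalVariety k) {W : X.toScheme.Opens}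
    (hW : IsAffineOpen W) [Nonempty W] : IsIntegrallyClosed Γ(X.toScheme, W) := by
  refine .of_localization_maximal fun P _ _ => ?_
  obtain ⟨x, hx⟩ := X.exists_isLocalization_stalk hW P
  let := X.toScheme.presheaf.algebra_section_stalk x
  have := X.isIntegrallyClosed_stalk x
  exact .of_equiv (IsLocalization.algEquiv P.primeCompl (X.toScheme.presheaf.stalk x.1)
    (Localization.AtPrime P)).toRingEquiv

theorem mem_range_of_ord_nonneg (X : NormalVariety k) {W : X.toScheme.Opens} (hW : IsAffineOpen W)
    [Nonempty W] {f : X.FunctionField} (hf : ∀ E : X.PrimeDivisor, E.1 ∈ W → 0 ≤ X.ord f E) :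
    f ∈ Set.range (algebraMap Γ(X.toScheme, W) X.FunctionField) := by
  by_contra hfW
  have : IsNoetherianRing Γ(X.toScheme, W) := IsLocallyNoetherian.component_noetherian ⟨W, hW⟩
  have := functionField_isFractionRing_of_isAffineOpen X.toScheme W hW
  have := X.isIntegrallyClosed_section hW
  obtain ⟨P, hP, _, hPf⟩ := exists_prime_isDiscreteValuationRing_of_notMem_range hfW
  obtain ⟨x, hx⟩ := X.exists_isLocalization_stalk hW P
  let := X.toScheme.presheaf.algebra_section_stalk x
  have := functionField_isScalarTower X.toScheme W x
  have hdvr : IsDiscreteValuationRing (X.toScheme.presheaf.stalk x.1) :=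
    IsDiscreteValuationRing.RingEquivClass.isDiscreteValuationRing
      (IsLocalization.algEquiv P.primeCompl (Localization.AtPrime P)
        (X.toScheme.presheaf.stalk x.1))
  let E : X.PrimeDivisor := ⟨x, (X.isDiscreteValuationRing_stalk_iff x).mp hdvr⟩
  obtain ⟨r, rfl⟩ : f ∈ Set.range (algebraMap (X.toScheme.presheaf.stalk x.1) X.FunctionField) :=
    fracOrd_nonneg_iff.mp (X.ord_eq_fracOrd f E ▸ hf E x.2)
  obtain ⟨⟨a, s⟩, has⟩ := IsLocalization.surj P.primeCompl r
  refine s.2 (hPf s ⟨a, ?_⟩)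
  rw [IsScalarTower.algebraMap_apply _ (X.toScheme.presheaf.stalk x.1), ← has, map_mul, mul_comm,
    ← IsScalarTower.algebraMap_apply]

theorem exists_isUnit_of_ord_eq_zero (X : NormalVariety k) {U : X.toScheme.Opens} {x : X.toScheme}
    (hx : x ∈ U) {f : X.FunctionField} (hf : f ≠ 0)
    (hU : ∀ E : X.PrimeDivisor, E.1 ∈ U → X.ord f E = 0) :
    ∃ r : X.toScheme.presheaf.stalk x, IsUnit r ∧ algebraMap _ X.FunctionField r = f := by
  obtain ⟨W, hW, hxW, hWU⟩ := X.exists_isAffineOpen hx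
  have : Nonempty W := ⟨⟨x, hxW⟩⟩
  obtain ⟨a, ha⟩ := X.mem_range_of_ord_nonneg hW fun E hE => (hU E (hWU hE)).ge
  obtain ⟨b, hb⟩ := X.mem_range_of_ord_nonneg hW (f := f⁻¹) fun E hE => by
    rw [ord_eq_fracOrd, fracOrd_inv, ← ord_eq_fracOrd, hU E (hWU hE), neg_zero]
  have hab : a * b = 1 := X.toScheme.germToFunctionField_injective W (by
    rw [map_mul, map_one]; exact ha ▸ hb ▸ mul_inv_cancel₀ hf)
  refine ⟨X.toScheme.presheaf.germ W x hxW a, (IsUnit.of_mul_eq_one b hab).map _, ?_⟩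
  exact (Scheme.algebraMap_germ_eq_germToFunctionField X.toScheme hxW a).trans ha

end NormalVariety

/-! ### Pull-back of rational functions and of `ℚ`-Cartier divisors -/

namespace NormalVariety

variable {k : Type u} [Field k]

theorem ord_mul (X : NormalVariety k) {f g : X.FunctionField} (hf : f ≠ 0) (hg : g ≠ 0)
    (E : X.PrimeDivisor) : X.ord (f * g) E = X.ord f E + X.ord g E := by
  simp only [ord_eq_fracOrd, fracOrd_mul hf hg]

theorem ord_pow (X : NormalVariety k) (f : X.FunctionField) (n : ℕ) (E : X.PrimeDivisor) :
    X.ord (f ^ n) E = n * X.ord f E := by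
  simp only [ord_eq_fracOrd, fracOrd_pow]

theorem ord_div (X : NormalVariety k) {f g : X.FunctionField} (hf : f ≠ 0) (hg : g ≠ 0)
    (E : X.PrimeDivisor) : X.ord (f / g) E = X.ord f E - X.ord g E := by
  simp only [ord_eq_fracOrd, div_eq_mul_inv, fracOrd_mul hf (inv_ne_zero hg), fracOrd_inv,
    sub_eq_add_neg]

namespace DominantMorphism

variable {X Y Z : NormalVariety k}

theorem functionFieldMap_algebraMap (φ : DominantMorphism Y X) (y : Y.toScheme)
    (r : X.toScheme.presheaf.stalk (φ.hom y)) :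
    φ.functionFieldMap (algebraMap _ X.FunctionField r) =
      algebraMap _ Y.FunctionField (φ.hom.stalkMap y r) := by
  have h : X.toScheme.presheaf.stalkSpecializes
      ((genericPoint_spec X.toScheme).specializes (y := φ.hom y) trivial) ≫ φ.functionFieldHom =
      φ.hom.stalkMap y ≫ Y.toScheme.presheaf.stalkSpecializes
        ((genericPoint_spec Y.toScheme).specializes trivial) := by
    rw [← Scheme.Hom.stalkSpecializes_stalkMap, functionFieldHom,
      TopCat.Presheaf.stalkSpecializes_comp_assoc]
  exact congrArg (fun ψ => ψ.hom r) h

theorem functionFieldMap_ne_zero (φ : DominantMorphism Y X) {f : X.FunctionField} (hf : f ≠ 0) :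
    φ.functionFieldMap f ≠ 0 :=
  (map_ne_zero φ.functionFieldMap).mpr hf

theorem ord_functionFieldMap_congr (φ : DominantMorphism Y X) {E : Y.PrimeDivisor}
    {U : X.toScheme.Opens} (hU : φ.hom E.1 ∈ U) {f g : X.FunctionField} (hf : f ≠ 0) (hg : g ≠ 0)
    (hfg : ∀ F : X.PrimeDivisor, F.1 ∈ U → X.ord f F = X.ord g F) :
    Y.ord (φ.functionFieldMap f) E = Y.ord (φ.functionFieldMap g) E := by
  obtain ⟨r, hr, hrfg⟩ := X.exists_isUnit_of_ord_eq_zero hU (div_ne_zero hf hg) fun F hF => by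
    rw [ord_div X hf hg, hfg F hF, sub_self]
  rw [← sub_eq_zero, ← ord_div Y (φ.functionFieldMap_ne_zero hf) (φ.functionFieldMap_ne_zero hg),
    ← map_div₀, ord_eq_fracOrd,
    fracOrd_eq_zero_iff (φ.functionFieldMap_ne_zero (div_ne_zero hf hg)), ← hrfg]
  exact ⟨_, hr.map (φ.hom.stalkMap E.1).hom, (φ.functionFieldMap_algebraMap E.1 r).symm⟩

theorem pullback_eq (φ : DominantMorphism Y X) {D : X.PrimeDivisor → ℚ} {E : Y.PrimeDivisor}
    {m : ℕ} {f : X.FunctionField} (hf : X.IsLocalEquation D (φ.hom E.1) m f) :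
    φ.pullback D E = (Y.ord (φ.functionFieldMap f) E : ℚ) / m := by
  have hex : ∃ p : ℕ × X.FunctionField, X.IsLocalEquation D (φ.hom E.1) p.1 p.2 := ⟨(m, f), hf⟩
  rw [pullback, dif_pos hex]
  obtain ⟨hm, hf0, U, hU, hUD⟩ := hf
  obtain ⟨hm', hf0', U', hU', hUD'⟩ := hex.choose_spec
  generalize hex.choose.1 = m', hex.choose.2 = f' at *
  have hpow := φ.ord_functionFieldMap_congr (U := U ⊓ U') ⟨hU, hU'⟩ (pow_ne_zero m hf0')
    (pow_ne_zero m' hf0) fun F hF => by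
      rw [← Int.cast_inj (α := ℚ), ord_pow, ord_pow, Int.cast_mul, Int.cast_mul, ← hUD F hF.1,
        ← hUD' F hF.2]
      push_cast
      ring
  rw [map_pow, map_pow, ord_pow, ord_pow] at hpow
  rw [div_eq_div_iff (by positivity) (by positivity), mul_comm, mul_comm _ (m' : ℚ)]
  exact_mod_cast hpow

/-- The composite `φ ∘ ψ`, written in the order of composition of arrows. -/
def comp (ψ : DominantMorphism Z Y) (φ : DominantMorphism Y X) : DominantMorphism Z X where
  hom := ψ.hom ≫ φ.hom
  comp_str := by rw [Category.assoc, φ.comp_str, ψ.comp_str]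
  isDominant := by
    have := ψ.isDominant
    have := φ.isDominant
    infer_instance

theorem functionFieldMap_comp (ψ : DominantMorphism Z Y) (φ : DominantMorphism Y X) :
    (ψ.comp φ).functionFieldMap = ψ.functionFieldMap.comp φ.functionFieldMap := by
  obtain ⟨z⟩ : Nonempty Z.toScheme := inferInstance
  refine AlgHom.coe_ringHom_injective (IsLocalization.ringHom_ext
    (nonZeroDivisors (X.toScheme.presheaf.stalk (φ.hom (ψ.hom z)))) (RingHom.ext fun r => ?_))
  refine ((ψ.comp φ).functionFieldMap_algebraMap z r).trans ?_
  change _ = ψ.functionFieldMap (φ.functionFieldMap _)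
  rw [functionFieldMap_algebraMap, functionFieldMap_algebraMap]
  exact congrArg (algebraMap _ Z.FunctionField)
    (congrArg (fun χ => χ.hom r) (Scheme.Hom.stalkMap_comp ψ.hom φ.hom z))

end DominantMorphism

variable {X Y Z : NormalVariety k} {D : X.PrimeDivisor → ℚ}

theorem IsLocalEquation.ord_add {x : X.toScheme} {m : ℕ} {f h : X.FunctionField}
    (hf : X.IsLocalEquation D x m f) (hh : h ≠ 0) :
    X.IsLocalEquation (fun E => X.ord h E + D E) x m (h ^ m * f) := by
  obtain ⟨hm, hf0, U, hU, hUD⟩ := hf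
  refine ⟨hm, mul_ne_zero (pow_ne_zero _ hh) hf0, U, hU, fun E hE => ?_⟩
  rw [mul_add, hUD E hE, ord_mul X (pow_ne_zero _ hh) hf0, ord_pow]
  push_cast
  rfl

theorem IsLocalEquation.pullback (φ : DominantMorphism Y X) {y : Y.toScheme} {m : ℕ}
    {f : X.FunctionField} (hf : X.IsLocalEquation D (φ.hom y) m f) :
    Y.IsLocalEquation (φ.pullback D) y m (φ.functionFieldMap f) := by
  obtain ⟨hm, hf0, U, hU, hUD⟩ := hf
  refine ⟨hm, φ.functionFieldMap_ne_zero hf0, φ.hom ⁻¹ᵁ U, hU, fun E hE => ?_⟩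
  rw [φ.pullback_eq ⟨hm, hf0, U, hE, hUD⟩, mul_div_cancel₀ _ (by positivity)]

theorem IsQCartier.ord_add (hD : X.IsQCartier D) {h : X.FunctionField} (hh : h ≠ 0) :
    X.IsQCartier fun E => X.ord h E + D E := by
  obtain ⟨m, hm, hloc⟩ := hD
  exact ⟨m, hm, fun x => (hloc x).elim fun f hf => ⟨_, hf.ord_add hh⟩⟩

theorem IsQCartier.pullback (hD : X.IsQCartier D) (φ : DominantMorphism Y X) :
    Y.IsQCartier (φ.pullback D) := by
  obtain ⟨m, hm, hloc⟩ := hD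
  exact ⟨m, hm, fun y => (hloc (φ.hom y)).elim fun f hf => ⟨_, hf.pullback φ⟩⟩

namespace DominantMorphism

theorem pullback_ord_add (φ : DominantMorphism Y X) (hD : X.IsQCartier D) {h : X.FunctionField}
    (hh : h ≠ 0) (E : Y.PrimeDivisor) :
    φ.pullback (fun F => X.ord h F + D F) E =
      Y.ord (φ.functionFieldMap h) E + φ.pullback D E := by
  obtain ⟨m, hm, hloc⟩ := hD
  obtain ⟨f, hf⟩ := hloc (φ.hom E.1)
  rw [φ.pullback_eq hf, φ.pullback_eq (hf.ord_add hh), map_mul, map_pow,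
    ord_mul Y (pow_ne_zero _ (φ.functionFieldMap_ne_zero hh)) (φ.functionFieldMap_ne_zero hf.2.1),
    ord_pow]
  push_cast
  rw [add_div, mul_div_cancel_left₀ _ (by positivity)]

theorem pullback_comp (ψ : DominantMorphism Z Y) (φ : DominantMorphism Y X)
    (hD : X.IsQCartier D) (E : Z.PrimeDivisor) :
    (ψ.comp φ).pullback D E = ψ.pullback (φ.pullback D) E := by
  obtain ⟨m, -, hloc⟩ := hD
  obtain ⟨f, hf⟩ := hloc (φ.hom (ψ.hom E.1))
  rw [ψ.pullback_eq (hf.pullback φ), (ψ.comp φ).pullback_eq hf, functionFieldMap_comp]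
  rfl

end DominantMorphism

end NormalVariety

/-! ### Spectra of normal domains of finite type -/

namespace NormalVariety

section Spec

variable (k B : Type u) [Field k] [CommRing B] [IsDomain B] [Algebra k B] [Algebra.FiniteType k B]
  [IsIntegrallyClosed B]

/-- The affine normal variety defined by a normal domain of finite type over `k`. -/
noncomputable def spec : NormalVariety k where
  toScheme := Spec (CommRingCat.of B)
  str := Spec.map (CommRingCat.ofHom (algebraMap k B))
  isIntegral := inferInstance
  isSeparated := inferInstance
  locallyOfFiniteType := by
    rw [HasRingHomProperty.Spec_iff (P := @LocallyOfFiniteType), CommRingCat.hom_ofHom]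
    exact RingHom.finiteType_algebraMap.mpr inferInstance
  quasiCompact := inferInstance
  isIntegrallyClosed_stalk y := by
    have := PrimeSpectrum.isPrime (R := B) y
    let : Algebra B ((Spec (CommRingCat.of B)).presheaf.stalk y) :=
      StructureSheaf.stalkAlgebra B y
    have : IsLocalization.AtPrime ((Spec (CommRingCat.of B)).presheaf.stalk y)
      (PrimeSpectrum.asIdeal y) := StructureSheaf.IsLocalization.to_stalk B y
    exact isIntegrallyClosed_of_isLocalization _ (PrimeSpectrum.asIdeal y).primeCompl
      (PrimeSpectrum.asIdeal y).primeCompl_le_nonZeroDivisors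

namespace spec

variable {k B}

noncomputable instance (y : (spec k B).toScheme) :
    Algebra B ((spec k B).toScheme.presheaf.stalk y) :=
  StructureSheaf.stalkAlgebra B y

noncomputable instance : Algebra B (spec k B).FunctionField :=
  StructureSheaf.stalkAlgebra B (genericPoint (spec k B).toScheme)

instance : IsFractionRing B (spec k B).FunctionField :=
  functionField_isFractionRing_of_affine (CommRingCat.of B)

instance (y : (spec k B).toScheme) :
    IsScalarTower B ((spec k B).toScheme.presheaf.stalk y) (spec k B).FunctionField :=
  .of_algebraMap_eq fun b => (congrArg (fun f => f.hom b)
    (StructureSheaf.toStalk_stalkSpecializes (R := B) (x := genericPoint (spec k B).toScheme)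
      (y := y) ((genericPoint_spec (spec k B).toScheme).specializes trivial))).symm

end spec

end Spec

variable {k : Type u} [Field k]

theorem fromSpec_str {X : NormalVariety k} {W : X.toScheme.Opens} (hW : IsAffineOpen W) :
    hW.fromSpec ≫ X.str = Spec.map (CommRingCat.ofHom (algebraMap k Γ(X.toScheme, W))) := by
  rw [← IsAffineOpen.SpecMap_appLE_fromSpec X.str (isAffineOpen_top _) hW le_top,
    ofHom_algebraMap_section, Spec.map_comp, IsAffineOpen.fromSpec_top, Scheme.isoSpec_Spec_inv]

theorem isDominant_specMap_fromSpec {X : Scheme.{u}} [IsIntegral X] {W : X.Opens}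
    (hW : IsAffineOpen W) [Nonempty W] {B : Type u} [CommRing B] {α : Γ(X, W) →+* B}
    (hα : Function.Injective α) :
    IsDominant (Spec.map (CommRingCat.ofHom α) ≫ hW.fromSpec) := by
  have : IsDominant (Spec.map (CommRingCat.ofHom α)) := by
    refine ⟨(PrimeSpectrum.denseRange_comap_iff_ker_le_nilRadical α).mpr ?_⟩
    rw [(RingHom.injective_iff_ker_eq_bot α).mp hα]
    exact bot_le
  have : IsDominant hW.fromSpec := by
    refine ⟨?_⟩
    rw [DenseRange, hW.range_fromSpec]
    exact W.isOpen.dense (by simpa using ‹Nonempty W›)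
  infer_instance

theorem specMap_fromSpec_app_germ {X : Scheme.{u}} {W : X.Opens} (hW : IsAffineOpen W)
    {B : Type u} [CommRing B] (α : Γ(X, W) →+* B) (y : Spec (CommRingCat.of B))
    (hy : (Spec.map (CommRingCat.ofHom α) ≫ hW.fromSpec) y ∈ W) :
    (Spec.map (CommRingCat.ofHom α) ≫ hW.fromSpec).app W ≫
      (Spec (CommRingCat.of B)).presheaf.germ _ y hy =
      CommRingCat.ofHom α ≫ StructureSheaf.toStalk B y := by
  have htoStalk : CommRingCat.ofHom α ≫ StructureSheaf.toStalk B y =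
      CommRingCat.ofHom α ≫ (Scheme.ΓSpecIso (CommRingCat.of B)).inv ≫
        (Spec (CommRingCat.of B)).presheaf.germ ⊤ y trivial := rfl
  change (hW.fromSpec.app W ≫ (Spec.map (CommRingCat.ofHom α)).app (hW.fromSpec ⁻¹ᵁ W)) ≫
    (Spec (CommRingCat.of B)).presheaf.germ
      (Spec.map (CommRingCat.ofHom α) ⁻¹ᵁ hW.fromSpec ⁻¹ᵁ W) y hy = _
  rw [htoStalk, hW.fromSpec_app_self, Scheme.ΓSpecIso_inv_naturality_assoc, Category.assoc,
    Category.assoc, Scheme.Hom.naturality_assoc]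
  exact congrArg ((Scheme.ΓSpecIso Γ(X, W)).inv ≫ (Spec.map (CommRingCat.ofHom α)).app ⊤ ≫ ·)
    ((Spec (CommRingCat.of B)).presheaf.germ_res
      ((TopologicalSpace.Opens.map (Spec.map (CommRingCat.ofHom α)).base).map
        (eqToHom hW.fromSpec_preimage_self)) y hy)

section SpecMap

variable {X : NormalVariety k} {W : X.toScheme.Opens} (hW : IsAffineOpen W) [Nonempty W]
  {B : Type u} [CommRing B] [IsDomain B] [Algebra k B] [Algebra.FiniteType k B]
  [IsIntegrallyClosed B] {α : Γ(X.toScheme, W) →ₐ[k] B} (hα : Function.Injective α)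

/-- The dominant morphism `Spec B → X` defined by an injective homomorphism `Γ(X, W) → B` for an
affine open `W` of `X`. -/
noncomputable def specMap : DominantMorphism (spec k B) X where
  hom := Spec.map (CommRingCat.ofHom (α : Γ(X.toScheme, W) →+* B)) ≫ hW.fromSpec
  comp_str := by
    change (Spec.map _ ≫ _) ≫ X.str = Spec.map (CommRingCat.ofHom (algebraMap k B))
    rw [Category.assoc, fromSpec_str, ← Spec.map_comp, ← CommRingCat.ofHom_comp, α.comp_algebraMap]
  isDominant := isDominant_specMap_fromSpec hW hα

theorem specMap_mem (y : (spec k B).toScheme) : (specMap hW hα).hom y ∈ W :=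
  hW.range_fromSpec.le ⟨_, rfl⟩

theorem functionFieldMap_specMap (a : Γ(X.toScheme, W)) :
    (specMap hW hα).functionFieldMap (algebraMap _ X.FunctionField a) =
      algebraMap B (spec k B).FunctionField (α a) := by
  have h : X.toScheme.germToFunctionField W ≫ (specMap hW hα).functionFieldHom =
      CommRingCat.ofHom (α : Γ(X.toScheme, W) →+* B) ≫
        StructureSheaf.toStalk B (genericPoint (spec k B).toScheme) := by
    rw [← specMap_fromSpec_app_germ hW _ _ (specMap_mem hW hα _),
      DominantMorphism.functionFieldHom, Scheme.germToFunctionField,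
      TopCat.Presheaf.germ_stalkSpecializes_assoc, Scheme.Hom.germ_stalkMap]
    rfl
  exact congrArg (fun f => f.hom a) h

variable [Algebra B X.FunctionField] [IsFractionRing B X.FunctionField]

theorem functionFieldMap_specMap_eq_algEquiv
    (hαX : ∀ a, algebraMap B X.FunctionField (α a) = algebraMap _ X.FunctionField a)
    (f : X.FunctionField) :
    (specMap hW hα).functionFieldMap f =
      IsLocalization.algEquiv (nonZeroDivisors B) X.FunctionField (spec k B).FunctionField f := by
  have := functionField_isFractionRing_of_isAffineOpen X.toScheme W hW
  refine RingHom.congr_fun (f := (specMap hW hα).functionFieldMap.toRingHom)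
    (g := (IsLocalization.algEquiv (nonZeroDivisors B) X.FunctionField
      (spec k B).FunctionField : X.FunctionField →+* (spec k B).FunctionField))
    (IsLocalization.ringHom_ext (nonZeroDivisors Γ(X.toScheme, W)) (RingHom.ext fun a => ?_)) f
  refine (functionFieldMap_specMap hW hα a).trans ?_
  simp [← hαX]

theorem isBirational_specMap
    (hαX : ∀ a, algebraMap B X.FunctionField (α a) = algebraMap _ X.FunctionField a) :
    (specMap hW hα).IsBirational := by
  rw [DominantMorphism.IsBirational, funext (functionFieldMap_specMap_eq_algEquiv hW hα hαX)]
  exact AlgEquiv.bijective _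

end SpecMap

end NormalVariety

/-! ### Divisors over a variety with a given local ring -/

theorem algEquiv_mem_range_iff {B R K R' K' : Type*} [CommRing B] [CommRing R] [CommRing K]
    [CommRing R'] [CommRing K'] [Algebra B R] [Algebra B K] [Algebra R K] [IsScalarTower B R K]
    [Algebra B R'] [Algebra B K'] [Algebra R' K'] [IsScalarTower B R' K'] (M : Submonoid B)
    [IsLocalization M R] [IsLocalization M R'] (σ : K ≃ₐ[B] K') (f : K) :
    σ f ∈ Set.range (algebraMap R' K') ↔ f ∈ Set.range (algebraMap R K) := by
  have hσ (r : R) :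
      σ (algebraMap R K r) = algebraMap R' K' (IsLocalization.algEquiv M R R' r) := by
    refine RingHom.congr_fun (f := (σ : K →+* K').comp (algebraMap R K))
      (g := (algebraMap R' K').comp (IsLocalization.algEquiv M R R' : R →+* R'))
      (IsLocalization.ringHom_ext M (RingHom.ext fun b => ?_)) r
    simp [← IsScalarTower.algebraMap_apply]
  refine ⟨?_, fun ⟨r, hr⟩ => ⟨_, hr ▸ (hσ r).symm⟩⟩
  rintro ⟨s, hs⟩
  obtain ⟨r, rfl⟩ := (IsLocalization.algEquiv M R R').surjective s
  exact ⟨r, σ.injective ((hσ r).trans hs)⟩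

namespace NormalVariety

open IsLocalRing

variable {k : Type u} [Field k]

theorem exists_isBirational_of_isNormalModel {X : NormalVariety k} {W : X.toScheme.Opens}
    (hW : IsAffineOpen W) [Nonempty W] {R : Type u} [CommRing R] [IsDomain R]
    [IsDiscreteValuationRing R] [Algebra k R] [Algebra R X.FunctionField]
    [IsFractionRing R X.FunctionField] {B : Subalgebra k R} (hB : IsNormalModel B)
    {α : Γ(X.toScheme, W) →ₐ[k] B}
    (hα : ∀ a, algebraMap R X.FunctionField (α a) = algebraMap _ X.FunctionField a) :
    ∃ (Y : NormalVariety k) (π : DominantMorphism Y X) (E : Y.PrimeDivisor),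
      π.IsBirational ∧ π.hom E.1 ∈ W ∧ ∀ f : X.FunctionField,
        π.functionFieldMap f ∈
            Set.range (algebraMap (Y.toScheme.presheaf.stalk E.1) Y.FunctionField) ↔
          f ∈ Set.range (algebraMap R X.FunctionField) := by
  have : Algebra.FiniteType k B := (Subalgebra.fg_iff_finiteType B).mp hB.fg
  have := hB.isIntegrallyClosed
  have := hB.isLocalization
  have hαinj : Function.Injective α := fun a b hab =>
    X.toScheme.germToFunctionField_injective W ((hα a).symm.trans (hab ▸ hα b))
  have : IsFractionRing B X.FunctionField := by
    have := functionField_isFractionRing_of_isAffineOpen X.toScheme W hW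
    have : FaithfulSMul B X.FunctionField := (faithfulSMul_iff_algebraMap_injective _ _).mpr
      ((IsFractionRing.injective R X.FunctionField).comp Subtype.val_injective)
    refine .of_field _ _ fun f => ?_
    obtain ⟨a, s, -, rfl⟩ := IsFractionRing.div_surjective (A := Γ(X.toScheme, W)) f
    exact ⟨α a, α s, congrArg₂ (· / ·) (hα a).symm (hα s).symm⟩
  let y : (spec k B).toScheme := (⟨(maximalIdeal R).under B, inferInstance⟩ : PrimeSpectrum B)
  let M := ((maximalIdeal R).under B).primeCompl
  have : IsLocalization M ((spec k B).toScheme.presheaf.stalk y) :=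
    StructureSheaf.IsLocalization.to_stalk B y
  have : IsDiscreteValuationRing ((spec k B).toScheme.presheaf.stalk y) :=
    IsDiscreteValuationRing.RingEquivClass.isDiscreteValuationRing
      (IsLocalization.algEquiv M R ((spec k B).toScheme.presheaf.stalk y))
  refine ⟨spec k B, specMap hW hαinj,
    ⟨y, ((spec k B).isDiscreteValuationRing_stalk_iff y).mp this⟩,
    isBirational_specMap hW hαinj hα, specMap_mem hW hαinj y, fun f => ?_⟩
  rw [functionFieldMap_specMap_eq_algEquiv hW hαinj hα]
  exact algEquiv_mem_range_iff M _ f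

variable [PerfectField k] {X Y' : NormalVariety k}

theorem exists_isBirational_mem_range_iff {φ : DominantMorphism Y' X} (hφ : φ.IsSeparable)
    (E' : Y'.PrimeDivisor) {U : X.toScheme.Opens} (hU : φ.hom E'.1 ∈ U) :
    ∃ (Y : NormalVariety k) (π : DominantMorphism Y X) (E : Y.PrimeDivisor),
      π.IsBirational ∧ π.hom E.1 ∈ U ∧ ∀ f : X.FunctionField,
        π.functionFieldMap f ∈
            Set.range (algebraMap (Y.toScheme.presheaf.stalk E.1) Y.FunctionField) ↔
          φ.functionFieldMap f ∈
            Set.range (algebraMap (Y'.toScheme.presheaf.stalk E'.1) Y'.FunctionField) := by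
  let V := comapRing φ.functionFieldMap (Y'.toScheme.presheaf.stalk E'.1)
  obtain ⟨W, hW, hxW, hWU⟩ := X.exists_isAffineOpen hU
  have : Nonempty W := ⟨⟨_, hxW⟩⟩
  have hmem (a : Γ(X.toScheme, W)) : algebraMap _ X.FunctionField a ∈ V :=
    ⟨_, ((congrArg φ.functionFieldMap
      (Scheme.algebraMap_germ_eq_germToFunctionField X.toScheme hxW a).symm).trans
        (φ.functionFieldMap_algebraMap E'.1 _)).symm⟩
  let ι : Γ(X.toScheme, W) →ₐ[k] V :=
    (IsScalarTower.toAlgHom k Γ(X.toScheme, W) X.FunctionField).codRestrict V hmem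
  have := X.finiteType_section hW
  have := comapRing.isDiscreteValuationRing (Y'.toScheme.presheaf.stalk E'.1) hφ
  obtain ⟨B₀, hB₀⟩ := comapRing.exists_isNormalModel (Y'.toScheme.presheaf.stalk E'.1) hφ
  obtain ⟨B, hB, hιB⟩ := hB₀.exists_le (D := ι.range)
    ((Subalgebra.fg_iff_finiteType _).mpr
      (.of_surjective ι.rangeRestrict ι.rangeRestrict_surjective))
  obtain ⟨Y, π, E, hπ, hπE, h⟩ := exists_isBirational_of_isNormalModel hW hB
    (α := ι.codRestrict B fun a => hιB ⟨a, rfl⟩) fun _ => rfl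
  refine ⟨Y, π, E, hπ, hWU hπE, fun f => (h f).trans ?_⟩
  rw [← comapRing.mem_iff]
  exact Subtype.range_coe.symm ▸ Iff.rfl

end NormalVariety

/-! ### Canonical divisors and discrepancies -/

namespace NormalVariety

variable {k : Type u} [Field k] {X Y Z : NormalVariety k} {ω : X.RationalForm} {Δ : X.QDivisor}

namespace DominantMorphism

variable {ψ : DominantMorphism Z Y} {φ : DominantMorphism Y X}

theorem IsSeparable.comp (hψ : ψ.IsSeparable) (hφ : φ.IsSeparable) : (ψ.comp φ).IsSeparable := by
  have h : IsSeparableHom (ψ.functionFieldMap.comp φ.functionFieldMap) := .comp hψ hφ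
  rwa [← functionFieldMap_comp] at h

theorem IsSeparable.topDegree_eq (hφ : φ.IsSeparable) : Y.topDegree = X.topDegree :=
  finrank_kaehlerDifferential_eq_of_isSeparableHom hφ

theorem IsBirational.isSeparable (hφ : φ.IsBirational) : φ.IsSeparable :=
  IsSeparableHom.of_bijective hφ

theorem IsBirational.exists_comp_eq {π : DominantMorphism Z X} (hπ : π.IsBirational)
    (φ : DominantMorphism Y X) :
    ∃ χ : Z.FunctionField →ₐ[k] Y.FunctionField,
      χ.comp π.functionFieldMap = φ.functionFieldMap :=
  ⟨φ.functionFieldMap.comp (AlgEquiv.ofBijective π.functionFieldMap hπ).symm.toAlgHom,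
    AlgHom.ext fun f => congrArg φ.functionFieldMap
      ((AlgEquiv.ofBijective π.functionFieldMap hπ).symm_apply_apply f)⟩

theorem pullbackForm_comp (ψ : DominantMorphism Z Y) (φ : DominantMorphism Y X)
    (hω : X.IsTopForm ω) : (ψ.comp φ).pullbackForm ω = ψ.pullbackForm (φ.pullbackForm ω) := by
  rw [pullbackForm, functionFieldMap_comp]
  exact (formPullback_formPullback φ.functionFieldMap ψ.functionFieldMap rfl hω.1).symm

end DominantMorphism

theorem IsTopForm.pullbackForm (hω : X.IsTopForm ω) {φ : DominantMorphism Y X}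
    (hφ : φ.IsSeparable) : Y.IsTopForm (φ.pullbackForm ω) := by
  rw [IsTopForm, hφ.topDegree_eq]
  exact ⟨formPullback_mem_exteriorPower φ.functionFieldMap rfl hω.1,
    formPullback_ne_zero hφ rfl hω.1 hω.2⟩

theorem IsTopForm.exists_eq_smul {ω' : X.RationalForm} (hω : X.IsTopForm ω)
    (hω' : X.IsTopForm ω') : ∃ h : X.FunctionField, h ≠ 0 ∧ ω' = h • ω := by
  obtain ⟨x, hx⟩ := exists_fin_span_D_eq_top (k := k) (K := X.FunctionField) rfl
  obtain ⟨c, hc⟩ := exists_eq_smul_ιMulti hx hω.1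
  obtain ⟨c', hc'⟩ := exists_eq_smul_ιMulti hx hω'.1
  have hc0 : c ≠ 0 := left_ne_zero_of_smul (hc ▸ hω.2)
  have hc0' : c' ≠ 0 := left_ne_zero_of_smul (hc' ▸ hω'.2)
  exact ⟨c' / c, div_ne_zero hc0' hc0, by rw [hc, hc', smul_smul, div_mul_cancel₀ _ hc0]⟩

theorem discrepancy_comp (π : DominantMorphism Z Y) (g : DominantMorphism Y X)
    (hω : X.IsTopForm ω) {Δ' : Y.QDivisor} (hX : X.IsQCartier (X.logCanonicalDivisor ω Δ))
    (hpull : g.pullback (X.logCanonicalDivisor ω Δ) =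
      Y.logCanonicalDivisor (g.pullbackForm ω) Δ') (E : Z.PrimeDivisor) :
    discrepancy (π.comp g) ω Δ E = discrepancy π (g.pullbackForm ω) Δ' E := by
  rw [discrepancy, discrepancy, π.pullbackForm_comp g hω, π.pullback_comp g hX, hpull]

variable [PerfectField k]

theorem IsTopForm.ordForm_smul (hω : X.IsTopForm ω) {h : X.FunctionField} (hh : h ≠ 0)
    (E : X.PrimeDivisor) : X.ordForm (h • ω) E = X.ord h E + X.ordForm ω E := by
  simp only [ordForm_eq_formOrd, ord_eq_fracOrd]
  exact formOrd_smul rfl hω.1 hω.2 hh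

theorem logCanonicalDivisor_smul (hω : X.IsTopForm ω) (Δ : X.QDivisor) {h : X.FunctionField}
    (hh : h ≠ 0) : X.logCanonicalDivisor (h • ω) Δ =
      fun E => X.ord h E + X.logCanonicalDivisor ω Δ E := by
  funext E
  rw [logCanonicalDivisor, logCanonicalDivisor, hω.ordForm_smul hh, Int.cast_add, add_assoc]

theorem discrepancy_smul {π : DominantMorphism Y X} (hπ : π.IsSeparable) (hω : X.IsTopForm ω)
    (hX : X.IsQCartier (X.logCanonicalDivisor ω Δ)) {h : X.FunctionField} (hh : h ≠ 0)
    (E : Y.PrimeDivisor) : discrepancy π (h • ω) Δ E = discrepancy π ω Δ E := by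
  have hform : π.pullbackForm (h • ω) = π.functionFieldMap h • π.pullbackForm ω :=
    formPullback_smul π.functionFieldMap h ω
  rw [discrepancy, discrepancy, hform, (hω.pullbackForm hπ).ordForm_smul
    (π.functionFieldMap_ne_zero hh), logCanonicalDivisor_smul hω Δ hh, π.pullback_ord_add hX hh]
  push_cast
  ring

theorem isLogCanonical_of_isTopForm (hω : X.IsTopForm ω)
    (hX : X.IsQCartier (X.logCanonicalDivisor ω Δ))
    (hdisc : ∀ (Y : NormalVariety k) (π : DominantMorphism Y X), π.IsBirational →
      ∀ E : Y.PrimeDivisor, -1 ≤ discrepancy π ω Δ E) : X.IsLogCanonical Δ := by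
  intro ω' hω'
  obtain ⟨h, hh, rfl⟩ := hω.exists_eq_smul hω'
  refine ⟨logCanonicalDivisor_smul hω Δ hh ▸ hX.ord_add hh, fun Y π hπ E => ?_⟩
  rw [discrepancy_smul hπ.isSeparable hω hX hh]
  exact hdisc Y π hπ E

theorem exists_ord_eq_mul_and_ordForm_le {π : DominantMorphism Y X} (hπ : π.IsBirational)
    {φ : DominantMorphism Z X} (hφ : φ.IsSeparable) (E : Y.PrimeDivisor) (E' : Z.PrimeDivisor)
    (h : ∀ f : X.FunctionField,
      π.functionFieldMap f ∈
          Set.range (algebraMap (Y.toScheme.presheaf.stalk E.1) Y.FunctionField) ↔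
        φ.functionFieldMap f ∈
          Set.range (algebraMap (Z.toScheme.presheaf.stalk E'.1) Z.FunctionField))
    (hω : X.IsTopForm ω) :
    ∃ e : ℕ, (∀ f, Z.ord (φ.functionFieldMap f) E' = e * Y.ord (π.functionFieldMap f) E) ∧
      e * (Y.ordForm (π.pullbackForm ω) E + 1) ≤ Z.ordForm (φ.pullbackForm ω) E' + 1 := by
  obtain ⟨χ, hχ⟩ := hπ.exists_comp_eq φ
  have hχφ (f : X.FunctionField) : χ (π.functionFieldMap f) = φ.functionFieldMap f :=
    AlgHom.congr_fun hχ f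
  have hχsep : IsSeparableHom χ := .of_comp (φ := π.functionFieldMap) (hχ ▸ hφ)
  obtain ⟨e, he, hord⟩ := exists_ramificationIdx (R := Y.toScheme.presheaf.stalk E.1)
    (R' := Z.toScheme.presheaf.stalk E'.1) χ.toRingHom fun f' => by
      obtain ⟨f, rfl⟩ := hπ.2 f'
      exact (h f).trans (hχφ f ▸ Iff.rfl)
  have hπω := hω.pullbackForm hπ.isSeparable
  have hform : formPullback χ (π.pullbackForm ω) = φ.pullbackForm ω := by
    rw [DominantMorphism.pullbackForm, DominantMorphism.pullbackForm, ← hχ]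
    exact formPullback_formPullback π.functionFieldMap χ rfl hω.1
  have hdeg : Z.topDegree = Y.topDegree := hφ.topDegree_eq.trans hπ.isSeparable.topDegree_eq.symm
  refine ⟨e, fun f => ?_, ?_⟩
  · rw [ord_eq_fracOrd, ord_eq_fracOrd, ← hχφ]
    exact hord _
  · rw [ordForm_eq_formOrd, ordForm_eq_formOrd, hdeg, ← hform]
    exact mul_formOrd_add_one_le hχsep he hord rfl hπω.1 hπω.2

theorem IsLogCanonical.neg_one_le_discrepancy (hlc : X.IsLogCanonical Δ) (hω : X.IsTopForm ω)
    {φ : DominantMorphism Y X} (hφ : φ.IsSeparable) (E' : Y.PrimeDivisor) :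
    -1 ≤ discrepancy φ ω Δ E' := by
  obtain ⟨⟨m, -, hm⟩, hdisc⟩ := hlc ω hω
  obtain ⟨f, hm0, hf0, U, hU, hUD⟩ := hm (φ.hom E'.1)
  obtain ⟨Z, π, E, hπ, hEU, hiff⟩ := exists_isBirational_mem_range_iff hφ E' hU
  obtain ⟨e, hord, hform⟩ := exists_ord_eq_mul_and_ordForm_le hπ hφ E E' hiff hω
  have hpull : φ.pullback (X.logCanonicalDivisor ω Δ) E' =
      e * π.pullback (X.logCanonicalDivisor ω Δ) E := by
    rw [φ.pullback_eq ⟨hm0, hf0, U, hU, hUD⟩, π.pullback_eq ⟨hm0, hf0, U, hEU, hUD⟩, hord,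
      Int.cast_mul, Int.cast_natCast, mul_div_assoc]
  have hform' : (e : ℚ) * (Z.ordForm (π.pullbackForm ω) E + 1) ≤
      Y.ordForm (φ.pullbackForm ω) E' + 1 := by exact_mod_cast hform
  have hE : (0 : ℚ) ≤ e * (discrepancy π ω Δ E + 1) :=
    mul_nonneg e.cast_nonneg (neg_le_iff_add_nonneg.mp (hdisc Z π hπ E))
  rw [discrepancy] at hE ⊢
  rw [hpull]
  linarith

end NormalVariety

theorem proposition4p5_general {k : Type u} [Field k] [PerfectField k]
    {X X' : NormalVariety k} {g : NormalVariety.DominantMorphism X' X} (hsep : g.IsSeparable)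
    {Δ : X.QDivisor} {Δ' : X'.QDivisor} {ω : X.RationalForm} (hω : X.IsTopForm ω)
    (hpull : g.pullback (X.logCanonicalDivisor ω Δ) =
      X'.logCanonicalDivisor (g.pullbackForm ω) Δ')
    (hlc : X.IsLogCanonical Δ) :
    X'.IsLogCanonical Δ' := by
  have hX : X.IsQCartier (X.logCanonicalDivisor ω Δ) := (hlc ω hω).1
  refine NormalVariety.isLogCanonical_of_isTopForm (hω.pullbackForm hsep)
    (hpull ▸ hX.pullback g) fun Y π hπ E => ?_
  rw [← NormalVariety.discrepancy_comp π g hω hX hpull]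
  exact hlc.neg_one_le_discrepancy hω (hπ.isSeparable.comp hsep) E

theorem proposition4p5 {k : Type u} [Field k] [IsAlgClosed k] (p : ℕ) (hp : 0 < p) [CharP k p]
    (X X' : NormalVariety k) (g : NormalVariety.DominantMorphism X' X)
    (hfin : IsFinite g.hom) (hsep : g.IsSeparable)
    (Δ : X.QDivisor) (Δ' : X'.QDivisor)
    (ω : X.RationalForm) (hω : X.IsTopForm ω)
    (hΔ : X.IsQCartier (X.logCanonicalDivisor ω Δ))
    (hpull : g.pullback (X.logCanonicalDivisor ω Δ) =
      X'.logCanonicalDivisor (g.pullbackForm ω) Δ')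
    (hlc : X.IsLogCanonical Δ) :
    X'.IsLogCanonical Δ' :=
  proposition4p5_general hsep hω hpull hlc
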